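/- Let $T$ be an oriented simply connected $1$-manifold: a simply connected, not necessarily Hausdorff, topological space with an atlas of charts onto open subsets of $\mathbb R$ whose transition functions are locally strictly increasing. For $x,y\in T$ let the geodesic spine $GS_{(x,y)}$ be the intersection of all paths in $T$ from $x$ to $y$. An infinite ray is a union $\rho=\bigcup_{i\ge 1} GS_{(x,x_i)}$ with $GS_{(x,x_i)}\subseteq GS_{(x,x_j)}$ for $i<j$ such that $(x_i)$ does not converge in $T$; two infinite rays are equivalent if their intersection contains an infinite ray, and an end of $T$ is an equivalence class of infinite rays. Let $G$ be a countable group acting on $T$ by orientation preserving homeomorphisms. Assume that - the action is minimal: the only nonempty $G$-invariant subset $A\subseteq T$ with $GS_{(x,y)}\subseteq A$ for all $x,y\in A$ is $A=T$; - $G$ does not fix a unique end, i.e. the number of ends of $T$ fixed by $G$ is not exactly one; - there is a point $x\in T$ whose stabilizer $\mathrm{Stab}(x)$ is left-orderable, i.e. admits a left-invariant total order. Then $G$ admits a nontrivial left-invariant rectifiable simply connected partial order. Here, for a partially ordered set $S$, write $x\sim_u y$ (resp. $x\sim_l y$) if $x,y$ are incomparable and have a common upper (resp. lower) bound. The order is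 simply connected if (strong connectedness) any incomparable $x,y$ satisfy $x\sim_u y$ or $x\sim_l y$, and (acyclicity) $x\sim_u y$ and $x\sim_l z$ imply $z>y$. It is trivial if there is at least one incomparable pair and either all incomparable pairs satisfy $\sim_u$ or all satisfy $\sim_l$; otherwise it is nontrivial. For $a\ne c$, an element $b$ is between $a$ and $c$ if one of the following holds, possibly after exchanging $a$ and $c$: $a<c$ and either $a<b<c$ or ($a\sim_u b$ and $b\sim_l c$); $a\sim_l c$, $a\sim_l b$ and $b<c$; $a\sim_u c$, $a\sim_u b$ and $b>c$. Let $B_{a,b}$ consist of $a$, $b$ and all elements between them (so $B_{a,a}=\{a\}$). The order is rectifiable if for all $a,b\in S$ the set $B_{a,b}$ is a union of finitely many classes of the relation $O_{a,b}$ on $B_{a,b}$, where $x\,O_{a,b}\,y$ means that $B_{x,y}$ is totally ordered. -/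

import Mathlib

open Set Filter Topology

/-! ### Simply connected, rectifiable and trivial partial orders -/

section Orders

variable {S : Type*} [PartialOrder S]

/-- `x ∼_u y`: the elements are incomparable and have a common upper bound. -/
def SimUpper (x y : S) : Prop :=
  IncompRel (· ≤ ·) x y ∧ ∃ z, x ≤ z ∧ y ≤ z

/-- `x ∼_l y`: the elements are incomparable and have a common lower bound. -/
def SimLower (x y : S) : Prop :=
  IncompRel (· ≤ ·) x y ∧ ∃ z, z ≤ x ∧ z ≤ y

variable (S) in
/-- Any two incomparable elements have a common upper bound or a common lower bound. -/
def IsStronglyConnectedOrder : Prop :=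
  ∀ x y : S, IncompRel (· ≤ ·) x y → SimUpper x y ∨ SimLower x y

variable (S) in
/-- If `x ∼_u y` and `x ∼_l z`, then `z > y`. -/
def IsAcyclicOrder : Prop :=
  ∀ x y z : S, SimUpper x y → SimLower x z → y < z

variable (S) in
/-- A partial order is simply connected if it is strongly connected and acyclic. -/
def IsSimplyConnectedOrder : Prop :=
  IsStronglyConnectedOrder S ∧ IsAcyclicOrder S

variable (S) in
/-- A (simply connected) partial order is trivial if some pair is incomparable and all incomparable
pairs are of one single type. In particular a total order is not trivial. -/
def IsTrivialOrder : Prop :=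
  (∃ x y : S, IncompRel (· ≤ ·) x y) ∧
    ((∀ x y : S, IncompRel (· ≤ ·) x y → SimUpper x y) ∨
      (∀ x y : S, IncompRel (· ≤ ·) x y → SimLower x y))

/-- `b` is between `a` and `c`. The notion is symmetric in `a` and `c`, so the case `c < a` is the
case `a < c` with the roles of `a` and `c` exchanged. -/
def OrdBetween (a b c : S) : Prop :=
  (a < c ∧ ((a < b ∧ b < c) ∨ (SimUpper a b ∧ SimLower b c))) ∨
  (c < a ∧ ((c < b ∧ b < a) ∨ (SimUpper c b ∧ SimLower b a))) ∨
  (SimLower a c ∧ ((SimLower a b ∧ b < c) ∨ (SimLower c b ∧ b < a))) ∨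
  (SimUpper a c ∧ ((SimUpper a b ∧ c < b) ∨ (SimUpper c b ∧ a < b)))

/-- The set `B_{a,b}` of `a`, `b` and all elements between them (so `B_{a,a} = {a}`). -/
def betweenSet (a b : S) : Set S :=
  {a, b} ∪ {x | OrdBetween a x b}

/-- The class of `x` in `B_{a,b}` for the relation `O_{a,b}`, where `x O_{a,b} y` means that
`B_{x,y}` is totally ordered. -/
def betweenClass (a b x : S) : Set S :=
  {y ∈ betweenSet a b | IsChain (· ≤ ·) (betweenSet x y)}

variable (S) in
/-- Every `B_{a,b}` is a union of finitely many classes of the relation `O_{a,b}`. -/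
def IsRectifiableOrder : Prop :=
  ∀ a b : S, (betweenClass a b '' betweenSet a b).Finite

end Orders

/-- The order on the group `G` is invariant under left translations. -/
def IsLeftInvariantOrder (G : Type*) [Group G] [PartialOrder G] : Prop :=
  ∀ f g h : G, g ≤ h → f * g ≤ f * h

/-- `H` admits a left-invariant total order. -/
def IsLeftOrderable (H : Type*) [Group H] : Prop :=
  ∃ _ : LinearOrder H, IsLeftInvariantOrder H

/-! ### Oriented 1-manifolds (not necessarily Hausdorff) -/

/-- `f` is strictly increasing near `t`. -/
def IsIncreasingNear (f : ℝ → ℝ) (t : ℝ) : Prop :=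
  ∃ U ∈ 𝓝 t, StrictMonoOn f U

/-- A space with an atlas of charts in `ℝ` is an oriented 1-manifold if all transition functions
are locally strictly increasing. No Hausdorff condition is imposed. -/
class IsOrientedOneManifold (T : Type*) [TopologicalSpace T] [ChartedSpace ℝ T] : Prop where
  increasing_transition : ∀ e ∈ atlas ℝ T, ∀ e' ∈ atlas ℝ T, ∀ x ∈ e.source ∩ e'.source,
    IsIncreasingNear (e' ∘ e.symm) (e x)

/-- A self-map of an oriented 1-manifold preserves the orientation if it is locally strictly
increasing in all oriented charts. -/
def IsOrientationPreserving {T : Type*} [TopologicalSpace T] [ChartedSpace ℝ T]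
    (f : T → T) : Prop :=
  ∀ e ∈ atlas ℝ T, ∀ e' ∈ atlas ℝ T, ∀ x ∈ e.source, f x ∈ e'.source →
    IsIncreasingNear (e' ∘ f ∘ e.symm) (e x)

/-! ### Geodesic spines, implicit subtrees, rays and ends -/

section Tree

variable {T : Type*} [TopologicalSpace T]

/-- The geodesic spine `GS_(x,y)`: the intersection of all paths from `x` to `y`. -/
def geodesicSpine (x y : T) : Set T :=
  ⋂ γ : Path x y, range γ

/-- An invariant implicit subtree: a nonempty `G`-invariant subset that contains the geodesic
spine of any two of its points. -/
def IsInvariantImplicitSubtree (G : Type*) [Group G] [MulAction G T] (A : Set T) : Prop :=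
  A.Nonempty ∧ (∀ g : G, ∀ x ∈ A, g • x ∈ A) ∧ ∀ x ∈ A, ∀ y ∈ A, geodesicSpine x y ⊆ A

variable (T) in
/-- The action has no proper invariant implicit subtree. -/
def IsTreeMinimalAction (G : Type*) [Group G] [MulAction G T] : Prop :=
  ∀ A : Set T, IsInvariantImplicitSubtree G A → A = univ

/-- An infinite ray: an increasing union of geodesic spines `GS_(x,x_i)` such that the sequence
`x_i` does not converge in the space. -/
def IsInfiniteRay (ρ : Set T) : Prop :=
  ∃ (x : T) (u : ℕ → T), (∀ i j, i < j → geodesicSpine x (u i) ⊆ geodesicSpine x (u j)) ∧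
    ρ = ⋃ i, geodesicSpine x (u i) ∧ ¬ ∃ a, Tendsto u atTop (𝓝 a)

/-- Two infinite rays are equivalent if their intersection contains an infinite ray. -/
def RayEquiv (ρ₁ ρ₂ : Set T) : Prop :=
  ∃ σ, IsInfiniteRay σ ∧ σ ⊆ ρ₁ ∩ ρ₂

/-- An end is an equivalence class of infinite rays. -/
def IsEnd (ε : Set (Set T)) : Prop :=
  ∃ ρ, IsInfiniteRay ρ ∧ ε = {ρ' | IsInfiniteRay ρ' ∧ RayEquiv ρ ρ'}

/-- The group fixes the end `ε`, where `g` sends the class of `ρ` to the class of `gρ`. -/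
def FixesEnd (G : Type*) [Group G] [MulAction G T] (ε : Set (Set T)) : Prop :=
  ∀ g : G, (fun ρ : Set T => (fun x => g • x) '' ρ) '' ε = ε

variable (T) in
/-- The group fixes exactly one end. -/
def FixesUniqueEnd (G : Type*) [Group G] [MulAction G T] : Prop :=
  ∃! ε : Set (Set T), IsEnd ε ∧ FixesEnd G ε

end Tree

/-! By simple connectedness every point cuts `T` into two connected open sides, which the
orientation names upper and lower; otherwise cutting at the point would give a double cover without
a section. The sides carry all later information. A spine consists of its endpoints and the points
separating them, and two distinct points are either one below the other, or face each other upwards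
or downwards. Sides are nested according to mutual position (`side_subset_side`), so "below" is a
strict partial order. `SideSystem` records these facts and replaces the manifold from then on.

`G` is ordered by pulling this order back along `g ↦ g • o`, where `o` has left-orderable
stabilizer, and by breaking ties inside the cosets of the stabilizer. Pairs facing upwards should be
`∼_u` and pairs facing downwards `∼_l`; acyclicity is then nesting of sides. The difficulty is that
the common bounds must lie in the orbit. `FaceUp.exists_upper` finds a bound in `T`, and minimality
moves it into the orbit as soon as the orbit also contains a pair facing downwards. So the orbit
must branch in both directions or not at all, which also gives nontriviality. If it branched upwards
only, it would be directed, countability would give a cofinal increasing sequence, and that sequence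
would define the only fixed end (`fixesUniqueEnd`), which is excluded. Reversing the orientation
treats the other case.

Rectifiability is compactness: elements between `a` and `b` map into a spine, the spine lies on a
path, and finitely many totally ordered intervals cover it, each meeting only one class. -/

/-! ### Cutting a simply connected space at a point -/

section TwoSides

variable {X : Type*} [TopologicalSpace X]

/-- The double cover of `X` obtained by cutting at the point `x`, of which a neighborhood is the
disjoint union of `{x}` and of the two open sides `A` and `B`. -/
noncomputable def cutDoubleCover (x : X) (A B : Set X) (hx : IsClosed ({x} : Set X)) (hA : IsOpen A)
    (hB : IsOpen B) (hAB : Disjoint A B) (hI : IsOpen ({x} ∪ (A ∪ B))) :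
    FiberBundleCore Bool X Bool where
  baseSet i := if i then {x} ∪ (A ∪ B) else {x}ᶜ
  isOpen_baseSet i := by
    cases i
    · simpa using hx
    · simpa using hI
  indexAt y := open Classical in decide (y = x)
  mem_baseSet_at y := by
    by_cases h : y = x <;> simp [h]
  coordChange i j y v := open Classical in if i = j then v else if y ∈ A then !v else v
  coordChange_self i y _ v := by simp
  continuousOn_coordChange i j := by
    by_cases hij : i = j
    · simpa [hij] using continuousOn_snd
    · simp only [hij, if_false]
      rintro ⟨y, v⟩ ⟨⟨h1, h2⟩, -⟩
      have hy : y ∈ A ∨ y ∈ B := by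
        cases i <;> cases j <;> simp at h1 h2 hij <;> tauto
      apply ContinuousAt.continuousWithinAt
      rcases hy with hy | hy
      · have : ContinuousAt (fun p : X × Bool => !p.2) (y, v) :=
          ((continuous_of_discreteTopology (f := not)).comp continuous_snd).continuousAt
        refine this.congr ?_
        filter_upwards [(hA.preimage continuous_fst).mem_nhds (show (y, v).1 ∈ A from hy)] with p hp
        simp [show p.1 ∈ A from hp]
      · have : ContinuousAt (fun p : X × Bool => p.2) (y, v) := continuous_snd.continuousAt
        refine this.congr ?_
        filter_upwards [(hB.preimage continuous_fst).mem_nhds (show (y, v).1 ∈ B from hy)] with p hp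
        simp [show p.1 ∉ A from fun h => hAB.le_bot ⟨h, hp⟩]
  coordChange_comp i j k y _ v := by
    by_cases h : y ∈ A <;> cases i <;> cases j <;> cases k <;> simp [h]

/-- In a simply connected space, a closed point that separates a neighborhood separates the space. -/
theorem exists_two_sides [SimplyConnectedSpace X] [LocallyPathConnectedSpace X]
    {x : X} {A B : Set X} (hx : IsClosed ({x} : Set X)) (hA : IsOpen A)
    (hB : IsOpen B) (hAB : Disjoint A B) (hI : IsOpen ({x} ∪ (A ∪ B))) :
    ∃ U V : Set X, IsOpen U ∧ IsOpen V ∧ Disjoint U V ∧ U ∪ V = {x}ᶜ ∧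
      ∀ᶠ y in 𝓝 x, y ≠ x → ((y ∈ A → y ∈ U) ∧ (y ∈ B → y ∈ V)) := by
  classical
  -- A section `s` of this cover exists. In the chart around `x` it is constant near `x`; the chart
  -- on the complement reads the flipped value on `A` and the same value on `B`, so its two level
  -- sets separate the germs of `A` and `B`.
  let Z := cutDoubleCover x A B hx hA hB hAB hI
  have cov : IsCoveringMap (Bundle.TotalSpace.proj : Z.TotalSpace → X) :=
    FiberBundle.isCoveringMap
  obtain ⟨s, ⟨-, hs⟩, -⟩ := cov.existsUnique_continuousMap_lifts (ContinuousMap.id X) x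
    (⟨x, true⟩ : Z.TotalSpace) rfl
  have hsp : ∀ y, (s y).proj = y := fun y => congrFun hs y
  have cont : ∀ i, ContinuousOn (fun y => (Z.localTriv i (s y)).2) (Z.baseSet i) := by
    intro i
    refine continuous_snd.comp_continuousOn ((Z.localTriv i).continuousOn.comp
      s.continuous.continuousOn ?_)
    intro y hy
    rw [Z.mem_localTriv_source, hsp]
    exact hy
  let n : Bool → X → Bool := fun i y => (Z.localTriv i (s y)).2
  have hcontn : ContinuousOn (n false) {x}ᶜ := cont false
  have hcontm : ContinuousOn (n true) ({x} ∪ (A ∪ B)) := cont true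
  have hrel : ∀ y ∈ A ∪ B, y ≠ x → n false y = if y ∈ A then !(n true y) else n true y := by
    intro y hy hyx
    have h1 : n false y = Z.coordChange (Z.indexAt (s y).proj) false (s y).proj (s y).2 := rfl
    have h2 : n true y = Z.coordChange (Z.indexAt (s y).proj) true (s y).proj (s y).2 := rfl
    have h3 := Z.coordChange_comp (Z.indexAt (s y).proj) true false (s y).proj (by
      refine ⟨⟨Z.mem_baseSet_at _, ?_⟩, ?_⟩ <;> rw [hsp]
      · exact Or.inr hy
      · exact hyx) (s y).2
    rw [h1, ← h3, ← h2, hsp]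
    simp [Z, cutDoubleCover]
  have hxo : IsOpen ({x}ᶜ : Set X) := hx.isOpen_compl
  have hop : ∀ b, IsOpen ({x}ᶜ ∩ n false ⁻¹' {b}) := fun b =>
    hcontn.isOpen_inter_preimage hxo (isOpen_discrete _)
  refine ⟨{x}ᶜ ∩ n false ⁻¹' {!(n true x)}, {x}ᶜ ∩ n false ⁻¹' {n true x}, hop _, hop _, ?_, ?_, ?_⟩
  · rw [Set.disjoint_left]
    rintro y ⟨-, h1⟩ ⟨-, h2⟩
    simp only [mem_preimage, mem_singleton_iff] at h1 h2
    rw [h1] at h2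
    simp at h2
  · rw [← inter_union_distrib_left, inter_eq_left]
    intro y _
    simp only [mem_union, mem_preimage, mem_singleton_iff]
    cases n false y <;> cases n true x <;> simp
  · have hev : ∀ᶠ y in 𝓝 x, y ∈ ({x} ∪ (A ∪ B)) ∩ n true ⁻¹' {n true x} :=
      (hcontm.isOpen_inter_preimage hI (isOpen_discrete _)).mem_nhds ⟨by simp, rfl⟩
    filter_upwards [hev] with y hy hyx
    obtain ⟨-, hy2⟩ := hy
    simp only [mem_preimage, mem_singleton_iff] at hy2
    refine ⟨fun h => ⟨hyx, ?_⟩, fun h => ⟨hyx, ?_⟩⟩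
    · simp [hrel y (Or.inl h) hyx, h, hy2]
    · have : y ∉ A := fun h' => hAB.le_bot ⟨h', h⟩
      simp [hrel y (Or.inr h) hyx, this, hy2]

end TwoSides

/-! ### Upper and lower sides in an oriented manifold -/

section Sides

variable {T : Type*} [TopologicalSpace T]

/-- If two points cut a connected space, nested sides are determined by mutual position. -/
theorem side_subset_side [PreconnectedSpace T] {x b : T} {U V U' V' : Set T}
    (hU : IsOpen U) (hV : IsOpen V) (hU' : IsOpen U') (hV' : IsOpen V')
    (hUV : Disjoint U V) (hUV' : Disjoint U' V') (h : U ∪ V = {x}ᶜ) (h' : U' ∪ V' = {b}ᶜ)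
    (hb : b ∈ V) (hx : x ∈ U') : U ⊆ U' := by
  -- The complement of `U ∩ V'` also contains `x` and `b`, but these are absorbed by `U'` and `V`.
  -- So `U ∩ V'` is clopen, and it misses `x`.
  have hc : (U ∩ V')ᶜ = V ∪ U' := by
    ext y
    have h1 : y ∈ U ∪ V ↔ y ≠ x := by rw [h]; rfl
    have h2 : y ∈ U' ∪ V' ↔ y ≠ b := by rw [h']; rfl
    have h3 : ¬ (y ∈ U ∧ y ∈ V) := fun h => hUV.le_bot h
    have h4 : ¬ (y ∈ U' ∧ y ∈ V') := fun h => hUV'.le_bot h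
    simp only [mem_union, mem_compl_iff, mem_inter_iff] at *
    by_cases e1 : y = x
    · subst e1; tauto
    · by_cases e2 : y = b
      · subst e2; tauto
      · tauto
  have hclopen : IsClopen (U ∩ V') :=
    ⟨by rw [← isOpen_compl_iff, hc]; exact hV.union hU', hU.inter hV'⟩
  rcases isClopen_iff.mp hclopen with h0 | h0
  · intro y hy
    have h2 : y ∈ U' ∪ V' := by
      rw [h']
      rintro rfl
      exact hUV.le_bot ⟨hy, hb⟩
    rcases h2 with h2 | h2
    · exact h2
    · exact absurd (show y ∈ U ∩ V' from ⟨hy, h2⟩) (by simp [h0])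
  · have : x ∈ U ∩ V' := by rw [h0]; trivial
    exact (hUV'.le_bot ⟨hx, this.2⟩).elim

/-- Only `x` can be a boundary point of `U`, and near `x` the side is contained in the connected set
`C`. Hence the piece of a splitting of `U` that avoids `C` is clopen in the whole space. -/
theorem isPreconnected_side [PreconnectedSpace T] {x : T} {U V C : Set T}
    (hU : IsOpen U) (hV : IsOpen V) (hUV : Disjoint U V) (h : U ∪ V = {x}ᶜ)
    (hC : IsPreconnected C) (hCU : C ⊆ U) (hgerm : ∀ᶠ y in 𝓝 x, y ∈ U → y ∈ C) :
    IsPreconnected U := by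
  have hxU : x ∉ U := fun hx => by
    have : x ∈ ({x}ᶜ : Set T) := h ▸ Or.inl hx
    exact this rfl
  have key : ∀ W W' : Set T, IsOpen W → IsOpen W' → U ⊆ W ∪ W' → Disjoint (U ∩ W) (U ∩ W') →
      C ⊆ W → U ∩ W' = ∅ := by
    intro W W' hW hW' hcov hdis hCW
    have hclopen : IsClopen (U ∩ W') := by
      refine ⟨⟨?_⟩, hU.inter hW'⟩
      rw [isOpen_iff_mem_nhds]
      intro y hy
      by_cases hyx : y = x
      · subst hyx
        filter_upwards [hgerm] with z hz hz'
        exact hdis.le_bot ⟨⟨hz'.1, hCW (hz hz'.1)⟩, hz'⟩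
      · have : y ∈ U ∪ V := by rw [h]; exact hyx
        rcases this with hyU | hyV
        · have : y ∈ W := (hcov hyU).resolve_right fun h => hy ⟨hyU, h⟩
          filter_upwards [(hU.inter hW).mem_nhds ⟨hyU, this⟩] with z hz hz'
          exact hdis.le_bot ⟨hz, hz'⟩
        · filter_upwards [hV.mem_nhds hyV] with z hz hz'
          exact hUV.le_bot ⟨hz'.1, hz⟩
    rcases isClopen_iff.mp hclopen with h0 | h0
    · exact h0
    · exact absurd (show x ∈ U ∩ W' by rw [h0]; trivial).1 hxU
  rw [isPreconnected_iff_subset_of_disjoint]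
  intro W W' hW hW' hcov hdis
  have hd : Disjoint (U ∩ W) (U ∩ W') := by
    rw [Set.disjoint_left]
    rintro y ⟨h1, h2⟩ ⟨-, h3⟩
    exact absurd (show y ∈ U ∩ (W ∩ W') from ⟨h1, h2, h3⟩) (by simp [hdis])
  rcases isPreconnected_iff_subset_of_disjoint.mp hC W W' hW hW' (hCU.trans hcov)
    (subset_empty_iff.mp (hdis ▸ inter_subset_inter_left _ hCU)) with hc | hc
  · left
    have := key W W' hW hW' hcov hd hc
    intro y hy
    exact (hcov hy).resolve_right fun h => absurd (show y ∈ U ∩ W' from ⟨hy, h⟩) (by simp [this])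
  · right
    have := key W' W hW' hW (by rwa [union_comm]) hd.symm hc
    intro y hy
    exact (hcov hy).resolve_left fun h => absurd (show y ∈ U ∩ W from ⟨hy, h⟩) (by simp [this])

theorem IsIncreasingNear.tendsto_Ioi {f : ℝ → ℝ} {t : ℝ} (h : IsIncreasingNear f t)
    (hf : ContinuousAt f t) : Tendsto f (𝓝[>] t) (𝓝[>] (f t)) := by
  obtain ⟨W, hW, hm⟩ := h
  refine tendsto_nhdsWithin_iff.mpr ⟨hf.mono_left nhdsWithin_le_nhds, ?_⟩
  filter_upwards [self_mem_nhdsWithin, mem_nhdsWithin_of_mem_nhds hW] with s hs hsW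
  exact hm (mem_of_mem_nhds hW) hsW hs

theorem IsIncreasingNear.tendsto_Iio {f : ℝ → ℝ} {t : ℝ} (h : IsIncreasingNear f t)
    (hf : ContinuousAt f t) : Tendsto f (𝓝[<] t) (𝓝[<] (f t)) := by
  obtain ⟨W, hW, hm⟩ := h
  refine tendsto_nhdsWithin_iff.mpr ⟨hf.mono_left nhdsWithin_le_nhds, ?_⟩
  filter_upwards [self_mem_nhdsWithin, mem_nhdsWithin_of_mem_nhds hW] with s hs hsW
  exact hm hsW (mem_of_mem_nhds hW) hs

section Transfer

variable {f : T → T} {x : T} {e e' : OpenPartialHomeomorph T ℝ}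

theorem continuousAt_in_charts (hf : ContinuousAt f x) (hx : x ∈ e.source)
    (hx' : f x ∈ e'.source) : ContinuousAt (e' ∘ f ∘ e.symm) (e x) := by
  have h1 : ContinuousAt e.symm (e x) := e.symm.continuousAt (e.map_source hx)
  have h2 : ContinuousAt f (e.symm (e x)) := by rwa [e.left_inv hx]
  have h3 : ContinuousAt e' (f (e.symm (e x))) := by
    rw [e.left_inv hx]; exact e'.continuousAt hx'
  exact ContinuousAt.comp (f := f ∘ e.symm) h3 (h2.comp h1)

theorem eventually_symm_charts (hf : ContinuousAt f x) (hx : x ∈ e.source)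
    (hx' : f x ∈ e'.source) :
    ∀ᶠ t in 𝓝 (e x), e'.symm ((e' ∘ f ∘ e.symm) t) = f (e.symm t) := by
  have h1 : ContinuousAt e.symm (e x) := e.symm.continuousAt (e.map_source hx)
  have h2 : ContinuousAt f (e.symm (e x)) := by rwa [e.left_inv hx]
  have h3 : ContinuousAt (f ∘ e.symm) (e x) := h2.comp h1
  have : ∀ᶠ t in 𝓝 (e x), (f ∘ e.symm) t ∈ e'.source :=
    h3.eventually_mem (e'.open_source.mem_nhds (by simpa [e.left_inv hx] using hx'))
  filter_upwards [this] with t ht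
  exact e'.left_inv ht

/-- Used twice: with `f = id` it makes the upper germ independent of the chart, and with `f = g • ·`
it transports germs by the group. -/
theorem eventually_upper_of_increasing (hf : ContinuousAt f x) (hx : x ∈ e.source)
    (hx' : f x ∈ e'.source) (h : IsIncreasingNear (e' ∘ f ∘ e.symm) (e x)) {W : Set T}
    (hW : ∀ᶠ s in 𝓝[>] (e' (f x)), e'.symm s ∈ W) : ∀ᶠ t in 𝓝[>] (e x), f (e.symm t) ∈ W := by
  have h1 := h.tendsto_Ioi (continuousAt_in_charts hf hx hx')
  have h2 : (e' ∘ f ∘ e.symm) (e x) = e' (f x) := by simp [e.left_inv hx]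
  rw [h2] at h1
  filter_upwards [h1.eventually hW, nhdsWithin_le_nhds (eventually_symm_charts hf hx hx')] with t h3 h4
  rwa [h4] at h3

theorem eventually_lower_of_increasing (hf : ContinuousAt f x) (hx : x ∈ e.source)
    (hx' : f x ∈ e'.source) (h : IsIncreasingNear (e' ∘ f ∘ e.symm) (e x)) {W : Set T}
    (hW : ∀ᶠ s in 𝓝[<] (e' (f x)), e'.symm s ∈ W) : ∀ᶠ t in 𝓝[<] (e x), f (e.symm t) ∈ W := by
  have h1 := h.tendsto_Iio (continuousAt_in_charts hf hx hx')
  have h2 : (e' ∘ f ∘ e.symm) (e x) = e' (f x) := by simp [e.left_inv hx]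
  rw [h2] at h1
  filter_upwards [h1.eventually hW, nhdsWithin_le_nhds (eventually_symm_charts hf hx hx')] with t h3 h4
  rwa [h4] at h3

end Transfer

theorem eventually_nhds_chart {x : T} {e : OpenPartialHomeomorph T ℝ} (hx : x ∈ e.source)
    {U V : Set T} (hU : ∀ᶠ t in 𝓝[>] (e x), e.symm t ∈ U)
    (hV : ∀ᶠ t in 𝓝[<] (e x), e.symm t ∈ V) :
    ∀ᶠ y in 𝓝 x, y = x ∨ (e x < e y ∧ y ∈ U) ∨ (e y < e x ∧ y ∈ V) := by
  have hU' := (e.continuousAt hx).eventually (eventually_nhdsWithin_iff.mp hU)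
  have hV' := (e.continuousAt hx).eventually (eventually_nhdsWithin_iff.mp hV)
  filter_upwards [hU', hV', e.open_source.mem_nhds hx] with y h1 h2 hy
  rw [e.left_inv hy] at h1 h2
  rcases lt_trichotomy (e y) (e x) with h | h | h
  · exact Or.inr (Or.inr ⟨h, h2 h⟩)
  · exact Or.inl (e.injOn hy hx h)
  · exact Or.inr (Or.inl ⟨h, h1 h⟩)

variable [ChartedSpace ℝ T]

/-- `U` and `V` are the two sides of `x`, with `U` the upper one in all oriented charts. -/
structure IsSidePair (x : T) (U V : Set T) : Prop where
  isOpen_upper : IsOpen U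
  isOpen_lower : IsOpen V
  disjoint : Disjoint U V
  union : U ∪ V = {x}ᶜ
  upper : ∀ e ∈ atlas ℝ T, x ∈ e.source → ∀ᶠ t in 𝓝[>] (e x), e.symm t ∈ U
  lower : ∀ e ∈ atlas ℝ T, x ∈ e.source → ∀ᶠ t in 𝓝[<] (e x), e.symm t ∈ V

/-- The orientation fixes which germ at `x` is upper, so `U ∩ V'` stays away from `x`; it is
therefore clopen, and empty. -/
theorem IsSidePair.upper_unique [PreconnectedSpace T] {x : T} {U V U' V' : Set T}
    (h : IsSidePair x U V) (h' : IsSidePair x U' V') : U ⊆ U' := by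
  let e := chartAt ℝ x
  have he : e ∈ atlas ℝ T := chart_mem_atlas ℝ x
  have hx : x ∈ e.source := mem_chart_source ℝ x
  have hxU : x ∉ U := fun hx => by
    have : x ∈ ({x}ᶜ : Set T) := h.union ▸ Or.inl hx
    exact this rfl
  have hclopen : IsClopen (U ∩ V') := by
    refine ⟨⟨?_⟩, h.isOpen_upper.inter h'.isOpen_lower⟩
    rw [isOpen_iff_mem_nhds]
    intro y hy
    by_cases hyx : y = x
    · subst hyx
      filter_upwards [eventually_nhds_chart hx ((h'.upper e he hx)) (h.lower e he hx)] with z hz hz'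
      rcases hz with rfl | ⟨-, hz⟩ | ⟨-, hz⟩
      · exact hxU hz'.1
      · exact h'.disjoint.le_bot ⟨hz, hz'.2⟩
      · exact h.disjoint.le_bot ⟨hz'.1, hz⟩
    · have h1 : y ∈ U ∪ V := by rw [h.union]; exact hyx
      have h2 : y ∈ U' ∪ V' := by rw [h'.union]; exact hyx
      have h3 : y ∈ V ∨ y ∈ U' := by
        simp only [mem_union, mem_compl_iff, mem_inter_iff] at *
        tauto
      rcases h3 with h3 | h3
      · filter_upwards [h.isOpen_lower.mem_nhds h3] with z hz hz'
        exact h.disjoint.le_bot ⟨hz'.1, hz⟩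
      · filter_upwards [h'.isOpen_upper.mem_nhds h3] with z hz hz'
        exact h'.disjoint.le_bot ⟨hz, hz'.2⟩
  rcases isClopen_iff.mp hclopen with h0 | h0
  · intro y hy
    have h2 : y ∈ U' ∪ V' := by
      rw [h'.union]
      rintro rfl
      exact hxU hy
    exact h2.resolve_right fun h3 => absurd (show y ∈ U ∩ V' from ⟨hy, h3⟩) (by simp [h0])
  · exact absurd (show x ∈ U ∩ V' by rw [h0]; trivial).1 hxU

theorem IsSidePair.lower_eq {x : T} {U V : Set T} (h : IsSidePair x U V) : V = {x}ᶜ \ U := by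
  rw [← h.union, union_sdiff_left, h.disjoint.symm.sdiff_eq_left]

theorem IsSidePair.unique [PreconnectedSpace T] {x : T} {U V U' V' : Set T}
    (h : IsSidePair x U V) (h' : IsSidePair x U' V') : U = U' ∧ V = V' := by
  have : U = U' := (h.upper_unique h').antisymm (h'.upper_unique h)
  exact ⟨this, by rw [h.lower_eq, h'.lower_eq, this]⟩

theorem exists_isSidePair [IsOrientedOneManifold T] [SimplyConnectedSpace T] (x : T) :
    ∃ U V : Set T, IsSidePair x U V := by
  have : LocallyPathConnectedSpace T := ChartedSpace.locallyPathConnectedSpace ℝ T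
  have : T1Space T := ChartedSpace.t1Space ℝ T
  let e := chartAt ℝ x
  have he : e ∈ atlas ℝ T := chart_mem_atlas ℝ x
  have hx : x ∈ e.source := mem_chart_source ℝ x
  have hI : {x} ∪ ((e.source ∩ e ⁻¹' Ioi (e x)) ∪ (e.source ∩ e ⁻¹' Iio (e x))) = e.source := by
    ext y
    simp only [mem_union, mem_singleton_iff, mem_inter_iff, mem_preimage, mem_Ioi, mem_Iio]
    refine ⟨?_, fun hy => ?_⟩
    · rintro (rfl | h | h)
      exacts [hx, h.1, h.1]
    · rcases lt_trichotomy (e y) (e x) with h | h | h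
      · exact Or.inr (Or.inr ⟨hy, h⟩)
      · exact Or.inl (e.injOn hy hx h)
      · exact Or.inr (Or.inl ⟨hy, h⟩)
  obtain ⟨U, V, hU, hV, hUV, hun, hg⟩ := exists_two_sides (x := x)
    (A := e.source ∩ e ⁻¹' Ioi (e x)) (B := e.source ∩ e ⁻¹' Iio (e x)) isClosed_singleton
    (e.isOpen_inter_preimage isOpen_Ioi) (e.isOpen_inter_preimage isOpen_Iio)
    (by
      rw [Set.disjoint_left]
      rintro y ⟨-, h1⟩ ⟨-, h2⟩
      exact lt_asymm (show e x < e y from h1) h2)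
    (by rw [hI]; exact e.open_source)
  have hg' : ∀ᶠ t in 𝓝 (e x), t ∈ e.target ∧ (e.symm t ≠ x →
      ((e.symm t ∈ e.source ∩ e ⁻¹' Ioi (e x) → e.symm t ∈ U) ∧
        (e.symm t ∈ e.source ∩ e ⁻¹' Iio (e x) → e.symm t ∈ V))) := by
    have h1 : ContinuousAt e.symm (e x) := e.symm.continuousAt (e.map_source hx)
    have h2 : Tendsto e.symm (𝓝 (e x)) (𝓝 x) := by
      simpa [ContinuousAt, e.left_inv hx] using h1
    have h3 : ∀ᶠ t in 𝓝 (e x), t ∈ e.target := e.open_target.mem_nhds (e.map_source hx)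
    exact h3.and (h2.eventually hg)
  have hup : ∀ᶠ t in 𝓝[>] (e x), e.symm t ∈ U := by
    filter_upwards [nhdsWithin_le_nhds hg', self_mem_nhdsWithin] with t ht htx
    refine (ht.2 ?_).1 ⟨e.map_target ht.1, by simpa [e.right_inv ht.1] using htx⟩
    intro hh
    have := e.right_inv ht.1
    rw [hh] at this
    simp [this] at htx
  have hlo : ∀ᶠ t in 𝓝[<] (e x), e.symm t ∈ V := by
    filter_upwards [nhdsWithin_le_nhds hg', self_mem_nhdsWithin] with t ht htx
    refine (ht.2 ?_).2 ⟨e.map_target ht.1, by simpa [e.right_inv ht.1] using htx⟩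
    intro hh
    have := e.right_inv ht.1
    rw [hh] at this
    simp [this] at htx
  refine ⟨U, V, hU, hV, hUV, hun, fun e' he' hx' => ?_, fun e' he' hx' => ?_⟩
  · exact eventually_upper_of_increasing (f := id) continuousAt_id hx' hx
      (IsOrientedOneManifold.increasing_transition e' he' e he x ⟨hx', hx⟩) hup
  · exact eventually_lower_of_increasing (f := id) continuousAt_id hx' hx
      (IsOrientedOneManifold.increasing_transition e' he' e he x ⟨hx', hx⟩) hlo

end Sides

/-! ### Side systems, and the one given by a manifold -/

/-- A space in which every point has an upper and a lower side, such that the geodesic spines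
are cut out by the sides and every point has small neighborhoods that look like intervals. -/
structure SideSystem (T : Type*) [TopologicalSpace T] where
  up : T → Set T
  dn : T → Set T
  isOpen_up : ∀ x, IsOpen (up x)
  isOpen_dn : ∀ x, IsOpen (dn x)
  disjoint : ∀ x, Disjoint (up x) (dn x)
  union : ∀ x, up x ∪ dn x = {x}ᶜ
  exists_interval : ∀ a, ∀ N ∈ 𝓝 a, ∃ J ⊆ N, J ∈ 𝓝 a ∧
    (∀ u ∈ J, ∀ v ∈ J, u ≠ v → (v ∈ up u ∧ u ∈ dn v) ∨ (u ∈ up v ∧ v ∈ dn u)) ∧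
    (∀ u ∈ J, ∀ v ∈ J, ∀ w, ((u ∈ up w ∧ v ∈ dn w) ∨ (u ∈ dn w ∧ v ∈ up w)) → w ∈ J) ∧
    (∃ q ∈ J, q ∈ up a ∧ a ∈ dn q) ∧ (∃ q ∈ J, q ∈ dn a ∧ a ∈ up q)
  spine : ∀ a b x, x ∈ geodesicSpine a b ↔
    x = a ∨ x = b ∨ (a ∈ up x ∧ b ∈ dn x) ∨ (a ∈ dn x ∧ b ∈ up x)

section OfManifold

variable {T : Type*} [TopologicalSpace T]

theorem right_mem_geodesicSpine (a b : T) : b ∈ geodesicSpine a b :=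
  mem_iInter.mpr fun γ => ⟨1, γ.target⟩

theorem left_mem_geodesicSpine (a b : T) : a ∈ geodesicSpine a b :=
  mem_iInter.mpr fun γ => ⟨0, γ.source⟩

theorem not_mem_left_side {T : Type*} {x : T} {U V : Set T} (h : U ∪ V = {x}ᶜ) : x ∉ U := fun hx => by
  have : x ∈ ({x}ᶜ : Set T) := h ▸ Or.inl hx
  exact this rfl

theorem not_mem_right_side {T : Type*} {x : T} {U V : Set T} (h : U ∪ V = {x}ᶜ) : x ∉ V :=
  not_mem_left_side (by rwa [union_comm])

theorem mem_of_isPreconnected_of_sides {x : T} {U V C : Set T} (hU : IsOpen U) (hV : IsOpen V)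
    (hUV : Disjoint U V) (h : U ∪ V = {x}ᶜ) (hC : IsPreconnected C) {a b : T} (ha : a ∈ C)
    (hb : b ∈ C) (haU : a ∈ U) (hbV : b ∈ V) : x ∈ C := by
  by_contra hx
  have hsub : C ⊆ U ∪ V := by
    rw [h]
    rintro y hy rfl
    exact hx hy
  rcases hC.subset_or_subset hU hV hUV hsub with hc | hc
  · exact hUV.le_bot ⟨hc hb, hbV⟩
  · exact hUV.le_bot ⟨haU, hc ha⟩

theorem mem_geodesicSpine_of_sides {x a b : T} {U V : Set T} (hU : IsOpen U) (hV : IsOpen V)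
    (hUV : Disjoint U V) (h : U ∪ V = {x}ᶜ) (ha : a ∈ U) (hb : b ∈ V) :
    x ∈ geodesicSpine a b ∧ x ∈ geodesicSpine b a := by
  refine ⟨mem_iInter.mpr fun γ => ?_, mem_iInter.mpr fun γ => ?_⟩
  · exact mem_of_isPreconnected_of_sides hU hV hUV h (isPreconnected_range γ.continuous)
      ⟨0, γ.source⟩ ⟨1, γ.target⟩ ha hb
  · exact mem_of_isPreconnected_of_sides hU hV hUV h (isPreconnected_range γ.continuous)
      ⟨1, γ.target⟩ ⟨0, γ.source⟩ ha hb

/-- A connected open side is path connected, so some path from `a` to `b` stays inside it and avoids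
`x`. -/
theorem not_mem_geodesicSpine_of_side [LocallyPathConnectedSpace T] {x a b : T} {U : Set T}
    (hU : IsOpen U) (hc : IsPreconnected U) (hx : x ∉ U) (ha : a ∈ U) (hb : b ∈ U) :
    x ∉ geodesicSpine a b := by
  have hp : IsPathConnected U := hU.isConnected_iff_isPathConnected.mp ⟨⟨a, ha⟩, hc⟩
  obtain ⟨γ, hγ⟩ := hp.joinedIn a ha b hb
  intro h
  obtain ⟨t, ht⟩ := mem_iInter.mp h γ
  exact hx (ht ▸ hγ t)

variable [ChartedSpace ℝ T]

theorem IsSidePair.isPreconnected [PreconnectedSpace T] {x : T} {U V : Set T}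
    (h : IsSidePair x U V) : IsPreconnected U ∧ IsPreconnected V := by
  let e := chartAt ℝ x
  have he : e ∈ atlas ℝ T := chart_mem_atlas ℝ x
  have hx : x ∈ e.source := mem_chart_source ℝ x
  have htar : ∀ᶠ t in 𝓝 (e x), t ∈ e.target := e.open_target.mem_nhds (e.map_source hx)
  constructor
  · obtain ⟨b, hb, hbU⟩ := mem_nhdsGT_iff_exists_Ioo_subset.mp
      ((h.upper e he hx).and (nhdsWithin_le_nhds htar))
    have hb' : e x < b := hb
    refine isPreconnected_side h.isOpen_upper h.isOpen_lower h.disjoint h.union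
      (C := e.symm '' Ioo (e x) b) ?_ ?_ ?_
    · exact isPreconnected_Ioo.image _ (e.symm.continuousOn.mono fun t ht => (hbU ht).2)
    · rintro _ ⟨t, ht, rfl⟩
      exact (hbU ht).1
    · have h1 : ∀ᶠ y in 𝓝 x, e y < b :=
        (e.continuousAt hx).eventually (gt_mem_nhds hb')
      filter_upwards [eventually_nhds_chart hx (h.upper e he hx) (h.lower e he hx), h1,
        e.open_source.mem_nhds hx] with y hy hyb hys hyU
      rcases hy with rfl | hy | hy
      · exact (not_mem_left_side h.union hyU).elim
      · exact ⟨e y, ⟨hy.1, hyb⟩, e.left_inv hys⟩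
      · exact (h.disjoint.le_bot ⟨hyU, hy.2⟩).elim
  · obtain ⟨b, hb, hbV⟩ := mem_nhdsLT_iff_exists_Ioo_subset.mp
      ((h.lower e he hx).and (nhdsWithin_le_nhds htar))
    have hb' : b < e x := hb
    refine isPreconnected_side h.isOpen_lower h.isOpen_upper h.disjoint.symm
      (by rw [union_comm]; exact h.union) (C := e.symm '' Ioo b (e x)) ?_ ?_ ?_
    · exact isPreconnected_Ioo.image _ (e.symm.continuousOn.mono fun t ht => (hbV ht).2)
    · rintro _ ⟨t, ht, rfl⟩
      exact (hbV ht).1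
    · have h1 : ∀ᶠ y in 𝓝 x, b < e y :=
        (e.continuousAt hx).eventually (lt_mem_nhds hb')
      filter_upwards [eventually_nhds_chart hx (h.upper e he hx) (h.lower e he hx), h1,
        e.open_source.mem_nhds hx] with y hy hyb hys hyV
      rcases hy with rfl | hy | hy
      · exact (not_mem_right_side h.union hyV).elim
      · exact (h.disjoint.le_bot ⟨hy.2, hyV⟩).elim
      · exact ⟨e y, ⟨hyb, hy.1⟩, e.left_inv hys⟩

/-- In an oriented chart interval the sides are those of the real line. -/
theorem IsSidePair.mem_of_chart_lt {s t : ℝ} {e : OpenPartialHomeomorph T ℝ} (he : e ∈ atlas ℝ T)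
    (hst : s < t) (hI : Icc s t ⊆ e.target) {U V U' V' : Set T}
    (h : IsSidePair (e.symm s) U V) (h' : IsSidePair (e.symm t) U' V') :
    e.symm t ∈ U ∧ e.symm s ∈ V' := by
  have hs : s ∈ e.target := hI ⟨le_rfl, hst.le⟩
  have ht : t ∈ e.target := hI ⟨hst.le, le_rfl⟩
  constructor
  · have hC : IsPreconnected (e.symm '' Ioc s t) := isPreconnected_Ioc.image _
      (e.symm.continuousOn.mono fun r hr => hI (Ioc_subset_Icc_self hr))
    have hsub : e.symm '' Ioc s t ⊆ U ∪ V := by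
      rw [h.union]
      rintro _ ⟨r, hr, rfl⟩ hrs
      exact hr.1.ne' (e.symm.injOn (hI (Ioc_subset_Icc_self hr)) hs hrs)
    have hev := h.upper e he (e.map_target hs)
    rw [e.right_inv hs] at hev
    obtain ⟨r, hr, hrU⟩ := (hev.and (Ioc_mem_nhdsGT hst)).exists
    rcases hC.subset_or_subset h.isOpen_upper h.isOpen_lower h.disjoint hsub with hc | hc
    · exact hc ⟨t, ⟨hst, le_rfl⟩, rfl⟩
    · exact (h.disjoint.le_bot ⟨hr, hc ⟨r, hrU, rfl⟩⟩).elim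
  · have hC : IsPreconnected (e.symm '' Ico s t) := isPreconnected_Ico.image _
      (e.symm.continuousOn.mono fun r hr => hI (Ico_subset_Icc_self hr))
    have hsub : e.symm '' Ico s t ⊆ U' ∪ V' := by
      rw [h'.union]
      rintro _ ⟨r, hr, rfl⟩ hrs
      exact hr.2.ne (e.symm.injOn (hI (Ico_subset_Icc_self hr)) ht hrs)
    have hev := h'.lower e he (e.map_target ht)
    rw [e.right_inv ht] at hev
    obtain ⟨r, hr, hrV⟩ := (hev.and (Ico_mem_nhdsLT hst)).exists
    rcases hC.subset_or_subset h'.isOpen_upper h'.isOpen_lower h'.disjoint hsub with hc | hc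
    · exact (h'.disjoint.le_bot ⟨hc ⟨r, hrV, rfl⟩, hr⟩).elim
    · exact hc ⟨s, ⟨le_rfl, hst⟩, rfl⟩

variable {G : Type*} [Group G] [MulAction G T] [ContinuousConstSMul G T]

theorem IsSidePair.preimage_smul (horient : ∀ g : G, IsOrientationPreserving (fun x : T => g • x))
    (g : G) {x : T} {U V : Set T} (h : IsSidePair (g • x) U V) :
    IsSidePair x ((g • ·) ⁻¹' U) ((g • ·) ⁻¹' V) where
  isOpen_upper := h.isOpen_upper.preimage (continuous_const_smul g)
  isOpen_lower := h.isOpen_lower.preimage (continuous_const_smul g)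
  disjoint := h.disjoint.preimage _
  union := by
    rw [← preimage_union, h.union]
    ext y
    simp
  upper e he hx := eventually_upper_of_increasing (f := fun y => g • y)
    (continuous_const_smul g).continuousAt hx (mem_chart_source ℝ (g • x))
    (horient g e he _ (chart_mem_atlas ℝ (g • x)) x hx (mem_chart_source ℝ (g • x)))
    (h.upper _ (chart_mem_atlas ℝ (g • x)) (mem_chart_source ℝ (g • x)))
  lower e he hx := eventually_lower_of_increasing (f := fun y => g • y)
    (continuous_const_smul g).continuousAt hx (mem_chart_source ℝ (g • x))
    (horient g e he _ (chart_mem_atlas ℝ (g • x)) x hx (mem_chart_source ℝ (g • x)))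
    (h.lower _ (chart_mem_atlas ℝ (g • x)) (mem_chart_source ℝ (g • x)))

variable [IsOrientedOneManifold T] [SimplyConnectedSpace T]

/-- The upper side of a point. -/
noncomputable def upperSide (x : T) : Set T := (exists_isSidePair x).choose

/-- The lower side of a point. -/
noncomputable def lowerSide (x : T) : Set T := (exists_isSidePair x).choose_spec.choose

theorem isSidePair_sides (x : T) : IsSidePair x (upperSide x) (lowerSide x) :=
  (exists_isSidePair x).choose_spec.choose_spec

variable (T) in
/-- The side system of an oriented simply connected 1-manifold. -/
noncomputable def manifoldSides : SideSystem T where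
  up := upperSide
  dn := lowerSide
  isOpen_up x := (isSidePair_sides x).isOpen_upper
  isOpen_dn x := (isSidePair_sides x).isOpen_lower
  disjoint x := (isSidePair_sides x).disjoint
  union x := (isSidePair_sides x).union
  exists_interval a N hN := by
    let e := chartAt ℝ a
    have he : e ∈ atlas ℝ T := chart_mem_atlas ℝ a
    have ha : a ∈ e.source := mem_chart_source ℝ a
    have h1 : Tendsto e.symm (𝓝 (e a)) (𝓝 a) := by
      simpa [ContinuousAt, e.left_inv ha] using e.symm.continuousAt (e.map_source ha)
    have h2 : e.target ∩ e.symm ⁻¹' N ∈ 𝓝 (e a) :=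
      inter_mem (e.open_target.mem_nhds (e.map_source ha)) (h1 hN)
    obtain ⟨δ, hδ, hI⟩ := Metric.mem_nhds_iff.mp h2
    rw [Real.ball_eq_Ioo] at hI
    have hIcc : ∀ s ∈ Ioo (e a - δ) (e a + δ), ∀ t ∈ Ioo (e a - δ) (e a + δ), Icc s t ⊆
        Ioo (e a - δ) (e a + δ) := fun s hs t ht r hr => ⟨hs.1.trans_le hr.1, hr.2.trans_lt ht.2⟩
    have hlt : ∀ s ∈ Ioo (e a - δ) (e a + δ), ∀ t ∈ Ioo (e a - δ) (e a + δ), s < t →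
        e.symm t ∈ upperSide (e.symm s) ∧ e.symm s ∈ lowerSide (e.symm t) :=
      fun s hs t ht hst => (isSidePair_sides _).mem_of_chart_lt he hst
        (fun r hr => (hI (hIcc s hs t ht hr)).1) (isSidePair_sides _)
    have hmem : e a ∈ Ioo (e a - δ) (e a + δ) := by constructor <;> linarith
    refine ⟨e.symm '' Ioo (e a - δ) (e a + δ), ?_, ?_, ?_, ?_, ?_, ?_⟩
    · rintro _ ⟨t, ht, rfl⟩
      exact (hI ht).2
    · have := e.symm.image_mem_nhds (x := e a) (e.map_source ha) (Ioo_mem_nhds hmem.1 hmem.2)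
      rwa [e.left_inv ha] at this
    · rintro _ ⟨s, hs, rfl⟩ _ ⟨t, ht, rfl⟩ hne
      rcases lt_trichotomy s t with h | h | h
      · exact Or.inl (hlt s hs t ht h)
      · exact absurd (by rw [h]) hne
      · exact Or.inr (hlt t ht s hs h)
    · have key : ∀ s ∈ Ioo (e a - δ) (e a + δ), ∀ t ∈ Ioo (e a - δ) (e a + δ), ∀ w,
          e.symm s ∈ upperSide w → e.symm t ∈ lowerSide w →
          w ∈ e.symm '' Ioo (e a - δ) (e a + δ) := by
        intro s hs t ht w hu hl
        have hsub : uIcc s t ⊆ Ioo (e a - δ) (e a + δ) := by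
          rcases le_total s t with h | h
          · rw [uIcc_of_le h]; exact hIcc s hs t ht
          · rw [uIcc_of_ge h]; exact hIcc t ht s hs
        have hC : IsPreconnected (e.symm '' uIcc s t) := isPreconnected_uIcc.image _
          (e.symm.continuousOn.mono fun r hr => (hI (hsub hr)).1)
        have hw := isSidePair_sides w
        exact image_mono hsub (mem_of_isPreconnected_of_sides hw.isOpen_upper hw.isOpen_lower
          hw.disjoint hw.union hC ⟨s, left_mem_uIcc, rfl⟩ ⟨t, right_mem_uIcc, rfl⟩ hu hl)
      rintro _ ⟨s, hs, rfl⟩ _ ⟨t, ht, rfl⟩ w (⟨h1, h2⟩ | ⟨h1, h2⟩)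
      · exact key s hs t ht w h1 h2
      · exact key t ht s hs w h2 h1
    · have hq : e a + δ / 2 ∈ Ioo (e a - δ) (e a + δ) := by constructor <;> linarith
      refine ⟨e.symm (e a + δ / 2), ⟨_, hq, rfl⟩, ?_⟩
      have := hlt _ hmem _ hq (by linarith)
      rwa [e.left_inv ha] at this
    · have hq : e a - δ / 2 ∈ Ioo (e a - δ) (e a + δ) := by constructor <;> linarith
      refine ⟨e.symm (e a - δ / 2), ⟨_, hq, rfl⟩, ?_⟩
      have := hlt _ hq _ hmem (by linarith)
      rw [e.left_inv ha] at this
      exact this.symm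
  spine a b x := by
    have : LocallyPathConnectedSpace T := ChartedSpace.locallyPathConnectedSpace ℝ T
    have hx := isSidePair_sides x
    constructor
    · intro h
      by_contra! hcon
      obtain ⟨hxa, hxb, h1, h2⟩ := hcon
      have ha : a ∈ upperSide x ∪ lowerSide x := by rw [hx.union]; exact hxa.symm
      have hb : b ∈ upperSide x ∪ lowerSide x := by rw [hx.union]; exact hxb.symm
      rcases ha with ha | ha
      · exact not_mem_geodesicSpine_of_side hx.isOpen_upper hx.isPreconnected.1
          (not_mem_left_side hx.union) ha (hb.resolve_right (h1 ha)) h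
      · exact not_mem_geodesicSpine_of_side hx.isOpen_lower hx.isPreconnected.2
          (not_mem_right_side hx.union) ha (hb.resolve_left (h2 ha)) h
    · rintro (rfl | rfl | h | h)
      · exact left_mem_geodesicSpine _ _
      · exact right_mem_geodesicSpine _ _
      · exact (mem_geodesicSpine_of_sides hx.isOpen_upper hx.isOpen_lower hx.disjoint hx.union
          h.1 h.2).1
      · exact (mem_geodesicSpine_of_sides hx.isOpen_upper hx.isOpen_lower hx.disjoint hx.union
          h.2 h.1).2

theorem smul_mem_sides_iff (horient : ∀ g : G, IsOrientationPreserving (fun x : T => g • x))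
    (g : G) (x y : T) : (g • y ∈ upperSide (g • x) ↔ y ∈ upperSide x) ∧
      (g • y ∈ lowerSide (g • x) ↔ y ∈ lowerSide x) := by
  obtain ⟨h1, h2⟩ := ((isSidePair_sides (g • x)).preimage_smul horient g).unique
    (isSidePair_sides x)
  constructor
  · rw [← h1]; rfl
  · rw [← h2]; rfl

end OfManifold

/-! ### Order and spines in a side system -/

namespace SideSystem

variable {T : Type*} [TopologicalSpace T] (S : SideSystem T)

/-- The side system with the opposite orientation. -/
def swap : SideSystem T where
  up := S.dn
  dn := S.up
  isOpen_up := S.isOpen_dn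
  isOpen_dn := S.isOpen_up
  disjoint x := (S.disjoint x).symm
  union x := by rw [union_comm]; exact S.union x
  exists_interval a N hN := by
    obtain ⟨J, h1, h2, h3, h4, h5, h6⟩ := S.exists_interval a N hN
    refine ⟨J, h1, h2, fun u hu v hv huv => (h3 v hv u hu huv.symm).imp (fun h => ?_) fun h => ?_,
      fun u hu v hv w h => h4 u hu v hv w h.symm, h6, h5⟩
    · exact ⟨h.2, h.1⟩
    · exact ⟨h.2, h.1⟩
  spine a b x := by
    rw [S.spine]
    tauto

/-- The order of the points: `y` is above `x` and `x` is below `y`. -/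
def Lt (x y : T) : Prop := y ∈ S.up x ∧ x ∈ S.dn y

/-- Each of two points lies above the other. -/
def FaceUp (x y : T) : Prop := y ∈ S.up x ∧ x ∈ S.up y

/-- Each of two points lies below the other. -/
def FaceDown (x y : T) : Prop := y ∈ S.dn x ∧ x ∈ S.dn y

theorem swap_lt {x y : T} : S.swap.Lt x y ↔ S.Lt y x := and_comm

theorem not_mem_up (x : T) : x ∉ S.up x := not_mem_left_side (S.union x)

theorem not_mem_dn (x : T) : x ∉ S.dn x := not_mem_right_side (S.union x)

theorem not_up_dn {x y : T} (h : y ∈ S.up x) : y ∉ S.dn x := fun h' => (S.disjoint x).le_bot ⟨h, h'⟩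

theorem up_or_dn {x y : T} (h : y ≠ x) : y ∈ S.up x ∨ y ∈ S.dn x := by
  have : y ∈ S.up x ∪ S.dn x := by rw [S.union]; exact h
  exact this

theorem trichotomy {x y : T} (h : x ≠ y) : S.Lt x y ∨ S.Lt y x ∨ S.FaceUp x y ∨ S.FaceDown x y := by
  unfold Lt FaceUp FaceDown
  have := S.up_or_dn h
  have := S.up_or_dn h.symm
  tauto

theorem geodesicSpine_comm (S : SideSystem T) (a b : T) : geodesicSpine a b = geodesicSpine b a := by
  ext x
  rw [S.spine, S.spine]
  tauto

theorem geodesicSpine_subset_union (S : SideSystem T) {z u v w : T} (hz : z ∈ geodesicSpine v w) :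
    z ∈ geodesicSpine v u ∨ z ∈ geodesicSpine u w := by
  simp only [S.spine] at *
  have := @S.up_or_dn
  grind

section Order

variable [PreconnectedSpace T] {x y z : T}

/-- This and the next three lemmas are the cases of one principle: the side of `x` away from `y`
lies in the side of `y` containing `x`. The `grind` proofs about spines rest on them. -/
theorem up_of_up (h1 : y ∈ S.dn x) (h2 : x ∈ S.up y) (h : z ∈ S.up x) : z ∈ S.up y :=
  side_subset_side (S.isOpen_up x) (S.isOpen_dn x) (S.isOpen_up y) (S.isOpen_dn y) (S.disjoint x)
    (S.disjoint y) (S.union x) (S.union y) h1 h2 h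

theorem up_of_dn (h1 : y ∈ S.up x) (h2 : x ∈ S.up y) (h : z ∈ S.dn x) : z ∈ S.up y :=
  side_subset_side (S.isOpen_dn x) (S.isOpen_up x) (S.isOpen_up y) (S.isOpen_dn y)
    (S.disjoint x).symm (S.disjoint y) (S.swap.union x) (S.union y) h1 h2 h

theorem dn_of_up (h1 : y ∈ S.dn x) (h2 : x ∈ S.dn y) (h : z ∈ S.up x) : z ∈ S.dn y :=
  S.swap.up_of_dn h1 h2 h

theorem dn_of_dn (h1 : y ∈ S.up x) (h2 : x ∈ S.dn y) (h : z ∈ S.dn x) : z ∈ S.dn y :=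
  S.swap.up_of_up h1 h2 h

theorem lt_trans (h : S.Lt x y) (h' : S.Lt y z) : S.Lt x z :=
  ⟨S.up_of_up h.2 h.1 h'.1, S.dn_of_dn h'.1 h'.2 h.2⟩

theorem geodesicSpine_subset (S : SideSystem T) {s v w : T} (hv : v ∈ geodesicSpine z w)
    (hs : s ∈ geodesicSpine z v) : s ∈ geodesicSpine z w := by
  simp only [S.spine] at *
  have := @S.not_up_dn
  have := @S.up_or_dn
  have := @S.up_of_up
  have := @S.up_of_dn
  have := @S.dn_of_up
  have := @S.dn_of_dn
  grind

theorem mem_geodesicSpine_of_mem (S : SideSystem T) {u v w : T} (hu : u ∈ geodesicSpine z v)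
    (hv : v ∈ geodesicSpine z w) : v ∈ geodesicSpine u w := by
  simp only [S.spine] at *
  have := @S.not_up_dn
  have := @S.up_or_dn
  have := @S.up_of_up
  have := @S.up_of_dn
  have := @S.dn_of_up
  have := @S.dn_of_dn
  grind

/-- A spine that starts below `u` and enters the upper side of `u` passes through `u` and never
returns, so what lies outside that side is the segment up to `u`. -/
theorem mem_geodesicSpine_of_not_mem_up (S : SideSystem T) {s p u w : T} (hx : x ∈ S.dn u)
    (hp : p ∈ S.up u) (hs : s ∉ S.up u) (hsw : s ∈ geodesicSpine x w)
    (hpw : p ∈ geodesicSpine x w) : s ∈ geodesicSpine x u := by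
  simp only [S.spine] at *
  have := @S.not_up_dn
  have := @S.up_or_dn
  have := @S.up_of_up
  have := @S.up_of_dn
  have := @S.dn_of_up
  have := @S.dn_of_dn
  grind

end Order

/-- A convex totally ordered set. -/
def IsInterval (J : Set T) : Prop :=
  (∀ u ∈ J, ∀ v ∈ J, u ≠ v → S.Lt u v ∨ S.Lt v u) ∧
    ∀ u ∈ J, ∀ v ∈ J, geodesicSpine u v ⊆ J

theorem exists_isInterval {a : T} {N : Set T} (hN : N ∈ 𝓝 a) : ∃ J ⊆ N, J ∈ 𝓝 a ∧
    S.IsInterval J ∧ (∃ q ∈ J, S.Lt a q) ∧ (∃ q ∈ J, S.Lt q a) := by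
  obtain ⟨J, h1, h2, h3, h4, h5, q, hq, h6⟩ := S.exists_interval a N hN
  refine ⟨J, h1, h2, ⟨h3, fun u hu v hv w hw => ?_⟩, h5, q, hq, h6.symm⟩
  rw [S.spine] at hw
  rcases hw with rfl | rfl | hw
  exacts [hu, hv, h4 u hu v hv w hw]

/-- The spine is contained in the compact range of any path. This is the source of the finiteness in
rectifiability. -/
theorem exists_finite_cover [PathConnectedSpace T] (a b : T) : ∃ F : Set (Set T), F.Finite ∧
    (∀ J ∈ F, S.IsInterval J) ∧ geodesicSpine a b ⊆ ⋃₀ F := by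
  let γ := PathConnectedSpace.somePath a b
  choose J _ hJ hI _ using fun c : T => S.exists_isInterval (univ_mem : univ ∈ 𝓝 c)
  obtain ⟨t, -, ht⟩ := (isCompact_range γ.continuous).elim_nhds_subcover J fun c _ => hJ c
  refine ⟨J '' t, t.finite_toSet.image J, ?_, fun x hx => ?_⟩
  · rintro _ ⟨c, -, rfl⟩
    exact hI c
  · have := ht (mem_iInter.mp hx γ)
    simpa using this

/-- Inside a spine, the sequence defining the ray has a cluster point `c` by compactness. Once it
enters an interval around `c` it stays there, since each later term lies on the spine between two
visits; so it converges, which a ray forbids. -/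
theorem not_subset_geodesicSpine (S : SideSystem T) [PathConnectedSpace T] {σ : Set T} (h : IsInfiniteRay σ)
    (a b : T) : ¬ σ ⊆ geodesicSpine a b := by
  obtain ⟨z, u, hmono, rfl, hconv⟩ := h
  intro hsub
  let γ := PathConnectedSpace.somePath a b
  have hu : ∀ i, u i ∈ range γ := fun i =>
    mem_iInter.mp (hsub (mem_iUnion.mpr ⟨i, right_mem_geodesicSpine _ _⟩)) γ
  obtain ⟨c, -, hc⟩ := (isCompact_range γ.continuous).exists_mapClusterPt (u := u) (f := atTop)
    (tendsto_principal.mpr (Eventually.of_forall hu))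
  refine hconv ⟨c, fun N hN => ?_⟩
  obtain ⟨J, hJN, hJ, hI, -⟩ := S.exists_isInterval hN
  have hfr : ∃ᶠ i in atTop, u i ∈ J := mapClusterPt_iff_frequently.mp hc J hJ
  have hle : ∀ i j, i ≤ j → u i ∈ geodesicSpine z (u j) := fun i j hij => by
    rcases hij.eq_or_lt with rfl | hij
    · exact right_mem_geodesicSpine _ _
    · exact hmono i j hij (right_mem_geodesicSpine _ _)
  obtain ⟨i, -, hi⟩ := frequently_atTop.mp hfr 0
  refine mem_atTop_sets.mpr ⟨i, fun j hij => hJN ?_⟩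
  obtain ⟨k, hk, hkJ⟩ := frequently_atTop.mp hfr j
  exact hI.2 _ hi _ hkJ (S.mem_geodesicSpine_of_mem (hle i j hij) (hle j k hk))

/-- Two points facing each other upwards have a common upper bound. -/
theorem FaceUp.exists_upper [PreconnectedSpace T] {x y : T} (h : S.FaceUp x y) :
    ∃ q, S.Lt x q ∧ S.Lt y q := by
  by_contra! hno
  -- The points reached by climbing from `x` while still facing `y`. Without a common upper bound
  -- the climb never leaves `P` (`hnext`), and the union `W` of the lower sides of `P` becomes
  -- clopen, with `x` inside and `y` outside.
  let P : Set T := {p | (p = x ∨ S.Lt x p) ∧ S.FaceUp p y}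
  have hlt : ∀ p q, p ∈ P → S.Lt p q → S.Lt x q := fun p q hp hq => by
    rcases hp.1 with rfl | hp
    exacts [hq, S.lt_trans hp hq]
  have hnext : ∀ p q J, p ∈ P → S.Lt p q → S.IsInterval J → p ∈ J → q ∈ J → q ∈ P := by
    intro p q J hp hpq hJ hpJ hqJ
    have hyq : y ≠ q := by
      rintro rfl
      exact S.not_up_dn hp.2.2 hpq.2
    have hq : q ∈ S.up y := by
      refine (S.up_or_dn hyq.symm).resolve_right fun hd => ?_
      have hyJ : y ∈ J := hJ.2 p hpJ q hqJ (by rw [S.spine]; exact Or.inr (Or.inr (Or.inl ⟨hp.2.2, hd⟩)))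
      have hpy : p ≠ y := by
        rintro rfl
        exact S.not_mem_up _ hp.2.1
      rcases hJ.1 p hpJ y hyJ hpy with h' | h'
      · exact S.not_up_dn hp.2.2 h'.2
      · exact S.not_up_dn hp.2.1 h'.2
    refine ⟨Or.inr (hlt p q hp hpq), ?_, hq⟩
    exact (S.up_or_dn hyq).resolve_right fun hd => hno q (hlt p q hp hpq) ⟨hq, hd⟩
  let W : Set T := ⋃ p ∈ P, S.dn p
  have hPW : P ⊆ W := fun p hp => by
    obtain ⟨J, -, hJ, hI, ⟨q, hq, hpq⟩, -⟩ := S.exists_isInterval (univ_mem : univ ∈ 𝓝 p)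
    exact mem_biUnion (hnext p q J hp hpq hI (mem_of_mem_nhds hJ) hq) hpq.2
  have hW : IsOpen W := isOpen_biUnion fun p _ => S.isOpen_dn p
  have hxW : x ∈ W := hPW ⟨Or.inl rfl, h⟩
  have hyW : y ∉ W := by
    simp only [W, mem_iUnion, not_exists]
    exact fun p hp => S.not_up_dn hp.2.1
  have hnc : ¬ IsClosed W := fun hc => by
    rcases isClopen_iff.mp ⟨hc, hW⟩ with h0 | h0
    · rw [h0] at hxW; exact hxW
    · rw [h0] at hyW; exact hyW trivial
  obtain ⟨c, hc, hcW⟩ : ∃ c ∈ closure W, c ∉ W := by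
    by_contra! hcon
    exact hnc (closure_subset_iff_isClosed.mp hcon)
  obtain ⟨J, -, hJ, hI, -⟩ := S.exists_isInterval (univ_mem : univ ∈ 𝓝 c)
  obtain ⟨w, hwJ, hwW⟩ := mem_closure_iff_nhds.mp hc J hJ
  have hcJ := mem_of_mem_nhds hJ
  obtain ⟨p, hp, hwp⟩ := mem_iUnion₂.mp hwW
  have hcp : c ≠ p := by
    rintro rfl
    exact hcW (hPW hp)
  have hcu : c ∈ S.up p := (S.up_or_dn hcp).resolve_right fun hd => hcW (mem_biUnion hp hd)
  have hpJ : p ∈ J := hI.2 c hcJ w hwJ (by rw [S.spine]; exact Or.inr (Or.inr (Or.inl ⟨hcu, hwp⟩)))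
  have hpc : S.Lt p c := (hI.1 p hpJ c hcJ hcp.symm).resolve_right fun h' => S.not_up_dn hcu h'.2
  exact hcW (hPW (hnext p c J hp hpc hI hpJ hcJ))

/-! ### The end defined by an unbounded increasing sequence -/

section Rays

variable [PathConnectedSpace T] {u : ℕ → T}

theorem isInfiniteRay_tail (h1 : ∀ n m, n < m → S.Lt (u n) (u m)) (h2 : ∀ p, ∃ n, p ∈ S.dn (u n))
    (m : ℕ) : IsInfiniteRay (⋃ i, geodesicSpine (u m) (u (m + i))) := by
  refine ⟨u m, fun i => u (m + i), fun i j hij s hs => ?_, rfl, ?_⟩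
  · refine S.geodesicSpine_subset ?_ hs
    rw [S.spine]
    rcases Nat.eq_zero_or_pos i with rfl | hi
    · exact Or.inl rfl
    · exact Or.inr (Or.inr (Or.inr ⟨(h1 m (m + i) (by omega)).2, (h1 (m + i) (m + j) (by omega)).1⟩))
  · rintro ⟨a, ha⟩
    obtain ⟨n, hn⟩ := h2 a
    obtain ⟨i, hi⟩ := (eventually_atTop.mp (ha ((S.isOpen_dn _).mem_nhds hn)))
    have h3 := hi (i + n + 1) (by omega)
    exact S.not_up_dn (h1 n (m + (i + n + 1)) (by omega)).1 h3

/-- Once the base point `x` of the ray lies below `u m`, a spine from `x` to a point above `u (m +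
i)` must pass through both `u m` and `u (m + i)`. -/
theorem subset_of_ray_meets (h1 : ∀ n m, n < m → S.Lt (u n) (u m))
    (h2 : ∀ p, ∃ n, p ∈ S.dn (u n)) {ρ : Set T} (hρ : IsInfiniteRay ρ)
    (hm : ∀ n, (ρ ∩ S.up (u n)).Nonempty) :
    ∃ m₀, ∀ m, m₀ ≤ m → ∀ i, geodesicSpine (u m) (u (m + i)) ⊆ ρ := by
  obtain ⟨x, v, hmono, rfl, -⟩ := hρ
  obtain ⟨m₀, hm₀⟩ := h2 x
  have hx : ∀ m, m₀ ≤ m → x ∈ S.dn (u m) := fun m hmm => by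
    rcases hmm.eq_or_lt with rfl | hmm
    exacts [hm₀, S.dn_of_dn (h1 _ _ hmm).1 (h1 _ _ hmm).2 hm₀]
  refine ⟨m₀, fun m hmm i s hs => ?_⟩
  obtain ⟨p, hp, hpu⟩ := hm (m + i)
  obtain ⟨j, hj⟩ := mem_iUnion.mp hp
  refine mem_iUnion.mpr ⟨j, S.geodesicSpine_subset hj ?_⟩
  have h3 : u (m + i) ∈ geodesicSpine x p := by
    rw [S.spine]
    exact Or.inr (Or.inr (Or.inr ⟨hx _ (by omega), hpu⟩))
  refine S.geodesicSpine_subset h3 ?_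
  have h4 : u m ∈ geodesicSpine x (u (m + i)) := by
    rw [S.spine]
    rcases Nat.eq_zero_or_pos i with rfl | hi
    · exact Or.inr (Or.inl rfl)
    · exact Or.inr (Or.inr (Or.inr ⟨hx m hmm, (h1 m (m + i) (by omega)).1⟩))
  rw [S.geodesicSpine_comm] at hs h4 ⊢
  exact S.geodesicSpine_subset h4 hs

theorem rayEquiv_of_meets (h1 : ∀ n m, n < m → S.Lt (u n) (u m))
    (h2 : ∀ p, ∃ n, p ∈ S.dn (u n)) {ρ ρ' : Set T} (hρ : IsInfiniteRay ρ)
    (hm : ∀ n, (ρ ∩ S.up (u n)).Nonempty) (hρ' : IsInfiniteRay ρ')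
    (hm' : ∀ n, (ρ' ∩ S.up (u n)).Nonempty) : RayEquiv ρ ρ' := by
  obtain ⟨m, h⟩ := S.subset_of_ray_meets h1 h2 hρ hm
  obtain ⟨m', h'⟩ := S.subset_of_ray_meets h1 h2 hρ' hm'
  refine ⟨_, S.isInfiniteRay_tail h1 h2 (max m m'), iUnion_subset fun i => ?_⟩
  exact subset_inter (h _ (le_max_left _ _) i) (h' _ (le_max_right _ _) i)

/-- If the common ray `σ` avoided the upper side of some `u n`, it would be trapped in a spine from
the base point of `ρ` to some `u k`, against `not_subset_geodesicSpine`. -/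
theorem meets_of_rayEquiv (h1 : ∀ n m, n < m → S.Lt (u n) (u m))
    (h2 : ∀ p, ∃ n, p ∈ S.dn (u n)) {ρ ρ' : Set T} (hρ : IsInfiniteRay ρ)
    (hm : ∀ n, (ρ ∩ S.up (u n)).Nonempty) (h : RayEquiv ρ ρ') (n : ℕ) :
    (ρ' ∩ S.up (u n)).Nonempty := by
  obtain ⟨σ, hσ, hsub⟩ := h
  by_contra hcon
  have hno : ∀ s ∈ σ, s ∉ S.up (u n) := fun s hs hsu => hcon ⟨s, (hsub hs).2, hsu⟩
  obtain ⟨x, v, hmono, rfl, -⟩ := hρ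
  obtain ⟨m, hxm⟩ := h2 x
  obtain ⟨k, hxk, hk⟩ : ∃ k, x ∈ S.dn (u k) ∧ ∀ s ∈ σ, s ∉ S.up (u k) := by
    rcases lt_trichotomy n m with h | rfl | h
    · exact ⟨m, hxm, fun s hs hsu => hno s hs (S.up_of_up (h1 _ _ h).2 (h1 _ _ h).1 hsu)⟩
    · exact ⟨n, hxm, hno⟩
    · exact ⟨n, S.dn_of_dn (h1 _ _ h).1 (h1 _ _ h).2 hxm, hno⟩
  refine S.not_subset_geodesicSpine hσ x (u k) fun s hs => ?_
  obtain ⟨i, hi⟩ := mem_iUnion.mp (hsub hs).1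
  obtain ⟨p, hp, hpu⟩ := hm k
  obtain ⟨j, hj⟩ := mem_iUnion.mp hp
  obtain ⟨l, hil, hjl⟩ : ∃ l, s ∈ geodesicSpine x (v l) ∧ p ∈ geodesicSpine x (v l) := by
    rcases lt_trichotomy i j with h | rfl | h
    · exact ⟨j, hmono _ _ h hi, hj⟩
    · exact ⟨i, hi, hj⟩
    · exact ⟨i, hi, hmono _ _ h hj⟩
  exact S.mem_geodesicSpine_of_not_mem_up hxk hpu (hk s hs) hil hjl

end Rays

end SideSystem

/-! ### Group actions: bounds in an orbit and fixed ends -/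

namespace SideSystem

variable {T : Type*} [TopologicalSpace T] (S : SideSystem T)
variable (G : Type*) [Group G] [MulAction G T]

/-- The group preserves the sides of all points. -/
def IsInvariant : Prop :=
  ∀ (g : G) (x y : T), (g • y ∈ S.up (g • x) ↔ y ∈ S.up x) ∧ (g • y ∈ S.dn (g • x) ↔ y ∈ S.dn x)

variable {S G}

namespace IsInvariant

theorem swap (h : S.IsInvariant G) : S.swap.IsInvariant G := fun g x y => (h g x y).symm

variable {x y : T}

theorem mem_up_iff (h : S.IsInvariant G) (g : G) : x ∈ S.up (g • y) ↔ g⁻¹ • x ∈ S.up y := by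
  rw [← (h g y (g⁻¹ • x)).1, smul_inv_smul]

theorem smul_lt (h : S.IsInvariant G) (g : G) : S.Lt (g • x) (g • y) ↔ S.Lt x y := and_congr (h g x y).1 (h g y x).2

theorem smul_faceUp (h : S.IsInvariant G) (g : G) : S.FaceUp (g • x) (g • y) ↔ S.FaceUp x y :=
  and_congr (h g x y).1 (h g y x).1

theorem smul_faceDown (h : S.IsInvariant G) (g : G) : S.FaceDown (g • x) (g • y) ↔ S.FaceDown x y := h.swap.smul_faceUp g

theorem image_geodesicSpine (h : S.IsInvariant G) (g : G) (a b : T) :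
    (fun x => g • x) '' geodesicSpine a b = geodesicSpine (g • a) (g • b) := by
  ext x
  obtain ⟨x, rfl⟩ : ∃ z, g • z = x := ⟨g⁻¹ • x, smul_inv_smul g x⟩
  rw [(MulAction.injective g).mem_set_image, S.spine, S.spine, (h g x a).1, (h g x a).2,
    (h g x b).1, (h g x b).2, smul_left_cancel_iff, smul_left_cancel_iff]

theorem isInfiniteRay_image [ContinuousConstSMul G T] (h : S.IsInvariant G) (g : G) {ρ : Set T} (hρ : IsInfiniteRay ρ) :
    IsInfiniteRay ((fun x => g • x) '' ρ) := by
  obtain ⟨x, u, hmono, rfl, hc⟩ := hρ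
  refine ⟨g • x, fun i => g • u i, fun i j hij => ?_, ?_, ?_⟩
  · rw [← h.image_geodesicSpine, ← h.image_geodesicSpine]
    exact image_mono (hmono i j hij)
  · simp only [image_iUnion, h.image_geodesicSpine]
  · rintro ⟨a, ha⟩
    refine hc ⟨g⁻¹ • a, ?_⟩
    simpa using ha.const_smul g⁻¹

theorem exists_lt (S : SideSystem T) (x : T) : ∃ q, S.Lt x q := by
  obtain ⟨J, -, -, -, ⟨q, -, hq⟩, -⟩ := S.exists_isInterval (univ_mem : univ ∈ 𝓝 x)
  exact ⟨q, hq⟩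

/-- By minimality the translates of an upper side cover the space. -/
theorem exists_mem_up [PreconnectedSpace T] (h : S.IsInvariant G) (hmin : IsTreeMinimalAction T G)
    (p q : T) : ∃ g : G, p ∈ S.up (g • q) := by
  by_contra! hcon
  -- The points missed by all translates form an invariant implicit subtree, which is proper because
  -- some point lies above `q`.
  have key := hmin {z | ∀ g : G, z ∉ S.up (g • q)} ⟨⟨p, hcon⟩, ?_, ?_⟩
  · obtain ⟨r, hr⟩ := exists_lt S q
    have : r ∈ {z | ∀ g : G, z ∉ S.up (g • q)} := key ▸ mem_univ r
    exact this 1 (by simpa using hr.1)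
  · intro g x hx k hk
    refine hx (g⁻¹ * k) ?_
    rwa [← (h g _ _).1, ← mul_smul, mul_inv_cancel_left]
  · intro x hx y hy w hw k hk
    have hx := hx k
    have hy := hy k
    rw [S.spine] at hw
    generalize k • q = c at *
    have := @S.not_up_dn
    have := @S.up_or_dn
    have h1 := fun z => S.up_of_up (x := w) (y := c) (z := z)
    have h2 := fun z => S.up_of_dn (x := w) (y := c) (z := z)
    have := S.not_mem_up c
    grind

/-- Some orbit point `v` lies in the upper side of `q`. If `q` is not below `v`, the two face
upwards, and an orbit point facing `v` downwards is then above `q`. -/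
theorem exists_gt [PreconnectedSpace T] (h : S.IsInvariant G) (hmin : IsTreeMinimalAction T G)
    {o : T} (hD : ∃ a b : G, S.FaceDown (a • o) (b • o)) (q : T) : ∃ k : G, S.Lt q (k • o) := by
  obtain ⟨g, hg⟩ := h.exists_mem_up hmin o q
  rw [h.mem_up_iff] at hg
  have hne : q ≠ g⁻¹ • o := by
    rintro h'
    rw [← h'] at hg
    exact S.not_mem_up _ hg
  rcases S.up_or_dn hne with hq | hq
  · obtain ⟨a, b, hab⟩ := hD
    have hv : S.FaceDown (g⁻¹ • o) ((g⁻¹ * a⁻¹ * b) • o) := by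
      rw [← h.smul_faceDown (g⁻¹ * a⁻¹)] at hab
      simpa [mul_smul] using hab
    exact ⟨_, S.up_of_dn hq hg hv.1, S.dn_of_up hv.1 hv.2 hq⟩
  · exact ⟨_, hg, hq⟩

theorem exists_upper_of_faceDown [PreconnectedSpace T] (h : S.IsInvariant G)
    (hmin : IsTreeMinimalAction T G) {o : T} (hD : ∃ a b : G, S.FaceDown (a • o) (b • o))
    {x y : T} (hxy : S.FaceUp x y) : ∃ k : G, S.Lt x (k • o) ∧ S.Lt y (k • o) := by
  obtain ⟨q, hxq, hyq⟩ := hxy.exists_upper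
  obtain ⟨k, hk⟩ := h.exists_gt hmin hD q
  exact ⟨k, S.lt_trans hxq hk, S.lt_trans hyq hk⟩

section OneSided

variable {o : T}

/-- Let `A` be the union of the lower sides of orbit points at or above `a • o`, and `R` that of
orbit points lying below none of these. Lower sides of orbit points cover the space, and orbit
points not comparable face upwards, so `A` and `R` are complementary open sets. Without a common
bound both would be nonempty. -/
theorem exists_upper_of_not_faceDown [PreconnectedSpace T] (h : S.IsInvariant G)
    (hD : ∀ a b : G, ¬ S.FaceDown (a • o) (b • o)) (hmin : IsTreeMinimalAction T G)
    {a b : G} (hab : S.FaceUp (a • o) (b • o)) :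
    ∃ k : G, S.Lt (a • o) (k • o) ∧ S.Lt (b • o) (k • o) := by
  have hcmp : ∀ v w : G, S.FaceUp (v • o) (w • o) ∨
      (v • o = w • o ∨ S.Lt (v • o) (w • o)) ∨ S.Lt (w • o) (v • o) := fun v w => by
    by_cases hvw : v • o = w • o
    · exact Or.inr (Or.inl (Or.inl hvw))
    · rcases S.trichotomy hvw with h' | h' | h' | h'
      · exact Or.inr (Or.inl (Or.inr h'))
      · exact Or.inr (Or.inr h')
      · exact Or.inl h'
      · exact absurd h' (hD v w)
  by_contra! hcon
  let le : G → G → Prop := fun v w => v • o = w • o ∨ S.Lt (v • o) (w • o)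
  have le_trans : ∀ {u v w}, le u v → le v w → le u w := fun {u v w} h1 h2 => by
    rcases h1 with h1 | h1
    · simpa only [le, h1] using h2
    · rcases h2 with h2 | h2
      · exact Or.inr (by rwa [← h2])
      · exact Or.inr (S.lt_trans h1 h2)
  have le_dn : ∀ {v w}, le v w → S.dn (v • o) ⊆ S.dn (w • o) := fun {v w} h1 z hz => by
    rcases h1 with h1 | h1
    · rwa [← h1]
    · exact S.dn_of_dn h1.1 h1.2 hz
  have hno : ∀ v, le a v → le b v → False := by
    rintro v (h1 | h1) (h2 | h2)
    · rw [h1, h2] at hab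
      exact S.not_mem_up _ hab.1
    · rw [← h1] at h2
      exact S.not_up_dn hab.1 h2.2
    · rw [← h2] at h1
      exact S.not_up_dn hab.2 h1.2
    · exact hcon v h1 h2
  let A : Set T := ⋃ v ∈ {v : G | le a v}, S.dn (v • o)
  let R : Set T := ⋃ w ∈ {w : G | ∀ v, le a v → ¬ le w v}, S.dn (w • o)
  have hA : IsOpen A := isOpen_biUnion fun v _ => S.isOpen_dn _
  have hR : IsOpen R := isOpen_biUnion fun v _ => S.isOpen_dn _
  have hAR : Aᶜ = R := by
    ext p
    simp only [A, R, mem_compl_iff, mem_iUnion, mem_ofPred_eq, not_exists]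
    constructor
    · intro hp
      obtain ⟨w, hw⟩ := h.swap.exists_mem_up hmin p o
      exact ⟨w, fun v hv hwv => hp v hv (le_dn hwv hw), hw⟩
    · rintro ⟨w, hw, hpw⟩ v hv hpv
      rcases hcmp v w with h' | h' | h'
      · exact S.not_up_dn (S.up_of_dn h'.1 h'.2 hpv) hpw
      · exact hw w (le_trans hv h') (Or.inl rfl)
      · exact hw v hv (Or.inr h')
  have hclopen : IsClopen A := ⟨⟨hAR ▸ hR⟩, hA⟩
  obtain ⟨r, hr⟩ := exists_lt S.swap (a • o)
  obtain ⟨s, hs⟩ := exists_lt S.swap (b • o)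
  have hrA : r ∈ A := mem_biUnion (show le a a from Or.inl rfl) hr.1
  have hsR : s ∈ R := mem_biUnion (show ∀ v, le a v → ¬ le b v from fun v h1 h2 => hno v h1 h2) hs.1
  rcases isClopen_iff.mp hclopen with h0 | h0
  · rw [h0] at hrA; exact hrA
  · rw [← hAR, h0] at hsR; exact hsR trivial

theorem exists_increasing_cofinal [PreconnectedSpace T] [Countable G] (h : S.IsInvariant G)
    (hD : ∀ a b : G, ¬ S.FaceDown (a • o) (b • o))
    (hmin : IsTreeMinimalAction T G)
    (hU : ∃ a b : G, S.FaceUp (a • o) (b • o)) :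
    ∃ w : ℕ → G, (∀ n m, n < m → S.Lt (w n • o) (w m • o)) ∧
      ∀ g : G, ∃ n, S.Lt (g • o) (w n • o) := by
  have hgt : ∀ v : G, ∃ k : G, S.Lt (v • o) (k • o) := fun v => by
    obtain ⟨a, b, hab⟩ := hU
    rw [← h.smul_faceUp (v * a⁻¹), ← mul_smul, ← mul_smul, inv_mul_cancel_right] at hab
    obtain ⟨k, hk, -⟩ := h.exists_upper_of_not_faceDown hD hmin hab
    exact ⟨k, hk⟩
  have hub : ∀ v w : G, ∃ k : G, S.Lt (v • o) (k • o) ∧ S.Lt (w • o) (k • o) := fun v w => by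
    by_cases hvw : v • o = w • o
    · obtain ⟨k, hk⟩ := hgt v
      exact ⟨k, hk, hvw ▸ hk⟩
    · rcases S.trichotomy hvw with h' | h' | h' | h'
      · obtain ⟨k, hk⟩ := hgt w
        exact ⟨k, S.lt_trans h' hk, hk⟩
      · obtain ⟨k, hk⟩ := hgt v
        exact ⟨k, hk, S.lt_trans h' hk⟩
      · exact h.exists_upper_of_not_faceDown hD hmin h'
      · exact absurd h' (hD v w)
  choose ub hub1 hub2 using hub
  obtain ⟨e, he⟩ := exists_surjective_nat G
  -- Each step passes strictly above the previous term and above the next element of an enumeration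
  -- of `G`.
  let w : ℕ → G := fun n => Nat.rec 1 (fun n v => ub v (e n)) n
  have hw : ∀ n, S.Lt (w n • o) (w (n + 1) • o) := fun n => hub1 _ _
  refine ⟨w, fun n m hnm => ?_, fun g => ?_⟩
  · induction m, hnm using Nat.le_induction with
    | base => exact hw n
    | succ m _ ih => exact S.lt_trans ih (hw m)
  · obtain ⟨n, rfl⟩ := he g
    exact ⟨n + 1, hub2 _ _⟩

/-- If the orbit branches upwards only, its upper bounds define the only fixed end. -/
theorem fixesUniqueEnd [PathConnectedSpace T] [Countable G] [ContinuousConstSMul G T]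
    (h : S.IsInvariant G)
    (hD : ∀ a b : G, ¬ S.FaceDown (a • o) (b • o))
    (hmin : IsTreeMinimalAction T G)
    (hU : ∃ a b : G, S.FaceUp (a • o) (b • o)) : FixesUniqueEnd T G := by
  obtain ⟨w, hw, hcof⟩ := h.exists_increasing_cofinal hD hmin hU
  have h2 : ∀ p, ∃ n, p ∈ S.dn (w n • o) := fun p => by
    obtain ⟨g, hg⟩ := h.swap.exists_mem_up hmin p o
    obtain ⟨n, hn⟩ := hcof g
    exact ⟨n, S.dn_of_dn hn.1 hn.2 hg⟩
  -- Rays going above every term of the cofinal sequence; cofinality makes this condition invariant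
  -- under `G`.
  let E : Set (Set T) := {ρ | IsInfiniteRay ρ ∧ ∀ n, (ρ ∩ S.up (w n • o)).Nonempty}
  have hclass : ∀ ρ ∈ E, E = {ρ' | IsInfiniteRay ρ' ∧ RayEquiv ρ ρ'} := fun ρ hρ => by
    ext ρ'
    exact ⟨fun h' => ⟨h'.1, S.rayEquiv_of_meets hw h2 hρ.1 hρ.2 h'.1 h'.2⟩,
      fun h' => ⟨h'.1, S.meets_of_rayEquiv hw h2 hρ.1 hρ.2 h'.2⟩⟩
  have hsub : ∀ g : G, ∀ ρ ∈ E, (fun x => g • x) '' ρ ∈ E := fun g ρ hρ => by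
    refine ⟨h.isInfiniteRay_image g hρ.1, fun n => ?_⟩
    obtain ⟨m, hm⟩ := hcof (g⁻¹ * w n)
    obtain ⟨x, hx, hxm⟩ := hρ.2 m
    refine ⟨g • x, mem_image_of_mem _ hx, ?_⟩
    have h3 := S.up_of_up hm.2 hm.1 hxm
    rwa [mul_smul, h.mem_up_iff, inv_inv] at h3
  refine ⟨E, ⟨?_, fun g => ?_⟩, ?_⟩
  · have h0 : (⋃ i, geodesicSpine (w 0 • o) (w (0 + i) • o)) ∈ E := by
      refine ⟨S.isInfiniteRay_tail hw h2 0, fun n => ⟨w (0 + (n + 1)) • o, ?_, ?_⟩⟩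
      · exact mem_iUnion.mpr ⟨n + 1, right_mem_geodesicSpine _ _⟩
      · exact (hw n _ (by omega)).1
    exact ⟨_, h0.1, hclass _ h0⟩
  · refine Subset.antisymm ?_ fun ρ hρ => ⟨_, hsub g⁻¹ ρ hρ, ?_⟩
    · rintro _ ⟨ρ, hρ, rfl⟩
      exact hsub g ρ hρ
    · simp [image_image]
  · rintro E' ⟨⟨ρ, hρ, rfl⟩, hfix⟩
    have hρE : ρ ∈ E := by
      refine ⟨hρ, fun n => ?_⟩
      by_contra hcon
      obtain ⟨a, b, hab⟩ := hU
      rw [← h.smul_faceUp (w n * a⁻¹), ← mul_smul, ← mul_smul, inv_mul_cancel_right] at hab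
      -- `k` is chosen so that `w n • o` and its translate by `k` face upwards; their upper sides
      -- then cover `T`. But a common point of `ρ` and `kρ` would lie in neither.
      let k := w n * a⁻¹ * b * (w n)⁻¹
      have hk : (w n * a⁻¹ * b) • o = k • w n • o := by simp [k, ← mul_smul]
      rw [hk] at hab
      have hmem : (fun x => k • x) '' ρ ∈ {ρ' | IsInfiniteRay ρ' ∧ RayEquiv ρ ρ'} := by
        rw [← hfix k]
        exact mem_image_of_mem _ ⟨hρ, ρ, hρ, by simp⟩
      obtain ⟨-, σ, ⟨x, u, -, rfl, -⟩, hσ⟩ := hmem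
      obtain ⟨hx, y, hy, rfl⟩ := hσ (mem_iUnion.mpr ⟨0, left_mem_geodesicSpine x (u 0)⟩)
      have hx' : k • y ∉ S.up (w n • o) := fun h' => hcon ⟨_, hx, h'⟩
      have hy' : k • y ∉ S.up (k • w n • o) := fun h' => hcon ⟨_, hy, (h k _ _).1.mp h'⟩
      by_cases hc : k • y = w n • o
      · exact hy' (hc ▸ hab.2)
      · exact hy' (S.up_of_dn hab.1 hab.2 ((S.up_or_dn hc).resolve_left hx'))
    exact (hclass ρ hρE).symm

end OneSided

/-- Unless the group fixes a unique end, points of an orbit facing each other have common bounds in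
the orbit, and the orbit branches in both directions or not at all. -/
theorem orbit_branching [PathConnectedSpace T] [Countable G] [ContinuousConstSMul G T]
    (h : S.IsInvariant G) (hmin : IsTreeMinimalAction T G) (hend : ¬ FixesUniqueEnd T G) (o : T) :
    (∀ a b : G, S.FaceUp (a • o) (b • o) → ∃ k : G, S.Lt (a • o) (k • o) ∧ S.Lt (b • o) (k • o)) ∧
    (∀ a b : G, S.FaceDown (a • o) (b • o) →
      ∃ k : G, S.Lt (k • o) (a • o) ∧ S.Lt (k • o) (b • o)) ∧
    ((∃ a b : G, S.FaceUp (a • o) (b • o)) ↔ ∃ a b : G, S.FaceDown (a • o) (b • o)) := by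
  have hUD : (∃ a b : G, S.FaceUp (a • o) (b • o)) ↔ ∃ a b : G, S.FaceDown (a • o) (b • o) := by
    constructor
    · intro hU
      by_contra! hD
      exact hend (h.fixesUniqueEnd hD hmin hU)
    · intro hD
      by_contra! hU
      exact hend (h.swap.fixesUniqueEnd (o := o) hU hmin hD)
  refine ⟨fun a b hab => h.exists_upper_of_faceDown hmin (hUD.mp ⟨a, b, hab⟩) hab,
    fun a b hab => ?_, hUD⟩
  obtain ⟨k, h1, h2⟩ := h.swap.exists_upper_of_faceDown hmin (o := o) (hUD.mpr ⟨a, b, hab⟩) hab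
  exact ⟨k, S.swap_lt.mp h1, S.swap_lt.mp h2⟩

end IsInvariant

end SideSystem

/-! ### Orders fibered over the points of an orbit -/

namespace SideSystem

variable {T : Type*} [TopologicalSpace T] (S : SideSystem T)
variable {X : Type*} [PartialOrder X]

/-- The order of `X` is obtained from the order of the points `φ x` by choosing total orders on the
fibers of `φ`, and points of the image facing each other have common bounds in the image. -/
structure IsFiberedOrder (φ : X → T) : Prop where
  le_of_lt : ∀ a b, S.Lt (φ a) (φ b) → a ≤ b
  lt_or_eq_of_le : ∀ a b, a ≤ b → S.Lt (φ a) (φ b) ∨ φ a = φ b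
  total_of_eq : ∀ a b, φ a = φ b → a ≤ b ∨ b ≤ a
  exists_upper : ∀ a b, S.FaceUp (φ a) (φ b) → ∃ k, S.Lt (φ a) (φ k) ∧ S.Lt (φ b) (φ k)
  exists_lower : ∀ a b, S.FaceDown (φ a) (φ b) → ∃ k, S.Lt (φ k) (φ a) ∧ S.Lt (φ k) (φ b)

/-- The spine from `p` to `q` is traversed upwards at its point `w`. -/
def Ascends (p q w : T) : Prop := (w = p ∧ q ∈ S.up p) ∨ p ∈ S.dn w

/-- If `w` comes before `w'` along the spine, then `w` and `p` are not separated by `w'`, nor `w'`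
and `q` by `w`. So `w` is below `w'` exactly when both are crossed upwards, and above it exactly
when both are crossed downwards. -/
theorem comparable_iff_ascends [PreconnectedSpace T] {p q w w' : T} (hw : w ∈ geodesicSpine p q)
    (hw' : w' ∈ geodesicSpine p q) (hne : w ≠ w') :
    (S.Lt w w' ∨ S.Lt w' w) ↔ (S.Ascends p q w ↔ S.Ascends p q w') := by
  simp only [S.spine] at hw hw'
  unfold Lt Ascends
  have := @S.not_mem_dn
  have := @S.not_up_dn
  have := @S.up_or_dn
  have := @S.up_of_up
  have := @S.up_of_dn
  have := @S.dn_of_up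
  have := @S.dn_of_dn
  grind

variable {S} {φ : X → T}

namespace IsFiberedOrder

theorem lt_of_lt (h : S.IsFiberedOrder φ) {a b : X} (hab : S.Lt (φ a) (φ b)) : a < b := by
  refine lt_of_le_not_ge (h.le_of_lt a b hab) fun hba => ?_
  rcases h.lt_or_eq_of_le b a hba with h' | h'
  · exact S.not_up_dn h'.1 hab.2
  · rw [h'] at hab
    exact S.not_mem_up _ hab.1

theorem incompRel_iff (h : S.IsFiberedOrder φ) {a b : X} :
    IncompRel (· ≤ ·) a b ↔ S.FaceUp (φ a) (φ b) ∨ S.FaceDown (φ a) (φ b) := by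
  constructor
  · intro hab
    have hne : φ a ≠ φ b := fun e => (h.total_of_eq a b e).elim hab.1 hab.2
    rcases S.trichotomy hne with h' | h' | h' | h'
    · exact absurd (h.le_of_lt _ _ h') hab.1
    · exact absurd (h.le_of_lt _ _ h') hab.2
    · exact Or.inl h'
    · exact Or.inr h'
  · have key : ∀ a b, S.FaceUp (φ a) (φ b) ∨ S.FaceDown (φ a) (φ b) → ¬ a ≤ b := by
      intro a b hab hle
      rcases h.lt_or_eq_of_le a b hle with h' | h'
      · rcases hab with hab | hab
        · exact S.not_up_dn hab.2 h'.2
        · exact S.not_up_dn h'.1 hab.1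
      · rw [h'] at hab
        exact hab.elim (fun e => S.not_mem_up _ e.1) fun e => S.not_mem_dn _ e.1
    exact fun hab => ⟨key a b hab, key b a (hab.imp And.symm And.symm)⟩

/-- For points facing downwards, the upper side of each lies in the lower side of the other, so they
have no common upper bound. -/
theorem simUpper_iff [PreconnectedSpace T] (h : S.IsFiberedOrder φ) {a b : X} :
    SimUpper a b ↔ S.FaceUp (φ a) (φ b) := by
  constructor
  · rintro ⟨hi, z, haz, hbz⟩
    refine (h.incompRel_iff.mp hi).resolve_right fun hd => ?_
    rcases h.lt_or_eq_of_le a z haz with h1 | h1 <;> rcases h.lt_or_eq_of_le b z hbz with h2 | h2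
    · exact S.not_up_dn h2.1 (S.dn_of_up hd.1 hd.2 h1.1)
    · rw [h2] at hd; exact S.not_up_dn h1.1 hd.1
    · rw [h1] at hd; exact S.not_up_dn h2.1 hd.2
    · rw [h1, h2] at hd; exact S.not_mem_dn _ hd.1
  · intro hf
    obtain ⟨k, h1, h2⟩ := h.exists_upper a b hf
    exact ⟨h.incompRel_iff.mpr (Or.inl hf), k, h.le_of_lt _ _ h1, h.le_of_lt _ _ h2⟩

theorem simLower_iff [PreconnectedSpace T] (h : S.IsFiberedOrder φ) {a b : X} :
    SimLower a b ↔ S.FaceDown (φ a) (φ b) := by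
  constructor
  · rintro ⟨hi, z, hza, hzb⟩
    refine (h.incompRel_iff.mp hi).resolve_left fun hd => ?_
    rcases h.lt_or_eq_of_le z a hza with h1 | h1 <;> rcases h.lt_or_eq_of_le z b hzb with h2 | h2
    · exact S.not_up_dn (S.up_of_dn hd.1 hd.2 h1.2) h2.2
    · rw [← h2] at hd; exact S.not_up_dn hd.1 h1.2
    · rw [← h1] at hd; exact S.not_up_dn hd.2 h2.2
    · rw [← h1, ← h2] at hd; exact S.not_mem_up _ hd.1
  · intro hf
    obtain ⟨k, h1, h2⟩ := h.exists_lower a b hf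
    exact ⟨h.incompRel_iff.mpr (Or.inr hf), k, h.le_of_lt _ _ h1, h.le_of_lt _ _ h2⟩

theorem isSimplyConnectedOrder [PreconnectedSpace T] (h : S.IsFiberedOrder φ) :
    IsSimplyConnectedOrder X := by
  refine ⟨fun x y hxy => ?_, fun x y z hy hz => ?_⟩
  · rw [h.simUpper_iff, h.simLower_iff]
    exact h.incompRel_iff.mp hxy
  · rw [h.simUpper_iff] at hy
    rw [h.simLower_iff] at hz
    exact h.lt_of_lt ⟨S.up_of_dn hy.1 hy.2 hz.1, S.dn_of_up hz.1 hz.2 hy.1⟩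

theorem not_isTrivialOrder [PreconnectedSpace T] (h : S.IsFiberedOrder φ)
    (hUD : (∃ a b, S.FaceUp (φ a) (φ b)) ↔ ∃ a b, S.FaceDown (φ a) (φ b)) :
    ¬ IsTrivialOrder X := by
  rintro ⟨⟨x, y, hxy⟩, ht⟩
  have hboth : (∃ a b, S.FaceUp (φ a) (φ b)) ∧ ∃ a b, S.FaceDown (φ a) (φ b) := by
    rcases h.incompRel_iff.mp hxy with h' | h'
    · exact ⟨⟨x, y, h'⟩, hUD.mp ⟨x, y, h'⟩⟩
    · exact ⟨hUD.mpr ⟨x, y, h'⟩, ⟨x, y, h'⟩⟩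
  obtain ⟨⟨a, b, hab⟩, c, d, hcd⟩ := hboth
  rcases ht with ht | ht
  · have := h.simUpper_iff.mp (ht c d (h.incompRel_iff.mpr (Or.inr hcd)))
    exact S.not_up_dn this.1 hcd.1
  · have := h.simLower_iff.mp (ht a b (h.incompRel_iff.mpr (Or.inl hab)))
    exact S.not_up_dn hab.1 this.1

theorem mem_geodesicSpine_of_mem_betweenSet [PreconnectedSpace T] (h : S.IsFiberedOrder φ)
    {a b x : X} (hx : x ∈ betweenSet a b) : φ x ∈ geodesicSpine (φ a) (φ b) := by
  rw [S.spine]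
  rcases hx with (rfl | rfl) | hx
  · exact Or.inl rfl
  · exact Or.inr (Or.inl rfl)
  · have hlt : ∀ {u v : X}, u < v → S.Lt (φ u) (φ v) ∨ φ u = φ v :=
      fun huv => h.lt_or_eq_of_le _ _ huv.le
    have hx : OrdBetween a x b := hx
    simp only [OrdBetween, h.simUpper_iff, h.simLower_iff] at hx
    unfold FaceUp FaceDown at hx
    unfold Lt at hlt
    grind

/-- The fibers of the endpoints are excluded because an element of the fiber of `a` may lie beyond
`a`, hence not between `a` and `b`. -/
theorem mem_betweenSet_of_mem_geodesicSpine [PreconnectedSpace T] (h : S.IsFiberedOrder φ)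
    {a b x : X} (hx : φ x ∈ geodesicSpine (φ a) (φ b)) (ha : φ x ≠ φ a) (hb : φ x ≠ φ b) :
    x ∈ betweenSet a b := by
  refine Or.inr (show OrdBetween a x b from ?_)
  have hlt : ∀ {u v : X}, S.Lt (φ u) (φ v) → u < v := h.lt_of_lt
  simp only [OrdBetween, h.simUpper_iff, h.simLower_iff]
  rw [S.spine] at hx
  unfold FaceUp FaceDown
  unfold Lt at hlt
  have h1 := @hlt a b
  have h2 := @hlt b a
  have h3 := @hlt a x
  have h4 := @hlt x a
  have h5 := @hlt x b
  have h6 := @hlt b x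
  clear hlt
  have := fun z => S.up_of_up (x := φ x) (y := φ a) (z := z)
  have := fun z => S.up_of_up (x := φ x) (y := φ b) (z := z)
  have := fun z => S.up_of_dn (x := φ x) (y := φ a) (z := z)
  have := fun z => S.up_of_dn (x := φ x) (y := φ b) (z := z)
  have := fun z => S.dn_of_up (x := φ x) (y := φ a) (z := z)
  have := fun z => S.dn_of_up (x := φ x) (y := φ b) (z := z)
  have := fun z => S.dn_of_dn (x := φ x) (y := φ a) (z := z)
  have := fun z => S.dn_of_dn (x := φ x) (y := φ b) (z := z)
  rcases hx with hx | hx | ⟨h7, h8⟩ | ⟨h7, h8⟩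
  · exact absurd hx ha
  · exact absurd hx hb
  all_goals rcases S.up_or_dn ha with h9 | h9 <;> rcases S.up_or_dn hb with h10 | h10 <;> grind

theorem comparable_iff_ascends [PreconnectedSpace T] (h : S.IsFiberedOrder φ) {p q : T} {u v : X}
    (hu : φ u ∈ geodesicSpine p q) (hv : φ v ∈ geodesicSpine p q) :
    (u ≤ v ∨ v ≤ u) ↔ (S.Ascends p q (φ u) ↔ S.Ascends p q (φ v)) := by
  by_cases huv : φ u = φ v
  · simp [huv, h.total_of_eq u v huv]
  · rw [← S.comparable_iff_ascends hu hv huv]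
    constructor
    · exact Or.imp (fun h' => (h.lt_or_eq_of_le _ _ h').resolve_right huv)
        (fun h' => (h.lt_or_eq_of_le _ _ h').resolve_right (Ne.symm huv))
    · exact Or.imp (h.le_of_lt _ _) (h.le_of_lt _ _)

/-- A set of elements over one spine is a chain when all are crossed in the same direction. An
element between `v` and `w` lies over the spine from `v` to `u`, inside the interval `J`, or over
that from `u` to `w`, where the chain condition applies; either way its direction is that of `u`. -/
theorem betweenClass_subset [PreconnectedSpace T] (h : S.IsFiberedOrder φ) {a b u v : X}
    (hu : u ∈ betweenSet a b) (hv : v ∈ betweenSet a b) {J : Set T} (hJ : S.IsInterval J)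
    (huJ : φ u ∈ J) (hvJ : φ v ∈ J) : betweenClass a b u ⊆ betweenClass a b v := by
  rintro w ⟨hw, hc⟩
  refine ⟨hw, ?_⟩
  have hu' := h.mem_geodesicSpine_of_mem_betweenSet hu
  have hv' := h.mem_geodesicSpine_of_mem_betweenSet hv
  have hw' := h.mem_geodesicSpine_of_mem_betweenSet hw
  have hsub : ∀ {c d e : T}, c ∈ geodesicSpine (φ a) (φ b) → d ∈ geodesicSpine (φ a) (φ b) →
      e ∈ geodesicSpine c d → e ∈ geodesicSpine (φ a) (φ b) := by
    intro c d e hc hd he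
    rcases S.geodesicSpine_subset_union (u := φ a) he with h' | h'
    · rw [S.geodesicSpine_comm] at h'
      exact S.geodesicSpine_subset hc h'
    · exact S.geodesicSpine_subset hd h'
  have key : ∀ z ∈ betweenSet v w, φ z ∈ geodesicSpine (φ a) (φ b) ∧
      (S.Ascends (φ a) (φ b) (φ z) ↔ S.Ascends (φ a) (φ b) (φ u)) := by
    intro z hz
    have hz' := h.mem_geodesicSpine_of_mem_betweenSet hz
    have hzab := hsub hv' hw' hz'
    refine ⟨hzab, ?_⟩
    have hchain : ∀ y ∈ betweenSet u w, φ y ∈ geodesicSpine (φ a) (φ b) →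
        (S.Ascends (φ a) (φ b) (φ y) ↔ S.Ascends (φ a) (φ b) (φ u)) := by
      intro y hy hyab
      rw [← h.comparable_iff_ascends hyab hu']
      exact hc.total hy (Or.inl (Or.inl rfl))
    by_cases hzu : φ z = φ u
    · rw [hzu]
    rcases S.geodesicSpine_subset_union (u := φ u) hz' with h' | h'
    · exact (S.comparable_iff_ascends hzab hu' hzu).mp
        (hJ.1 _ (hJ.2 _ hvJ _ huJ h') _ huJ hzu)
    · by_cases hzw : φ z = φ w
      · rw [hzw]
        exact hchain w (Or.inl (Or.inr rfl)) hw'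
      · exact hchain z (h.mem_betweenSet_of_mem_geodesicSpine h' hzu hzw) hzab
  intro y hy z hz _
  obtain ⟨hy1, hy2⟩ := key y hy
  obtain ⟨hz1, hz2⟩ := key z hz
  exact (h.comparable_iff_ascends hy1 hz1).mpr (hy2.trans hz2.symm)

theorem isRectifiableOrder [PathConnectedSpace T] (h : S.IsFiberedOrder φ) :
    IsRectifiableOrder X := by
  intro a b
  obtain ⟨F, hF, hI, hcov⟩ := S.exists_finite_cover (φ a) (φ b)
  refine (hF.biUnion (t := fun J => betweenClass a b '' {x ∈ betweenSet a b | φ x ∈ J})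
    fun J hJ => Set.Subsingleton.finite ?_).subset ?_
  · rintro _ ⟨u, ⟨hu, huJ⟩, rfl⟩ _ ⟨v, ⟨hv, hvJ⟩, rfl⟩
    exact (h.betweenClass_subset hu hv (hI J hJ) huJ hvJ).antisymm
      (h.betweenClass_subset hv hu (hI J hJ) hvJ huJ)
  · rintro _ ⟨u, hu, rfl⟩
    obtain ⟨J, hJ, huJ⟩ := hcov (h.mem_geodesicSpine_of_mem_betweenSet hu)
    exact mem_biUnion hJ ⟨u, ⟨hu, huJ⟩, rfl⟩

end IsFiberedOrder

/-- The order of a group induced by the order of an orbit and an order of the stabilizer. -/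
abbrev orbitOrder (S : SideSystem T) [PreconnectedSpace T] {G : Type*} [Group G] [MulAction G T]
    (o : T) [LinearOrder (MulAction.stabilizer G o)]
    (hL : IsLeftInvariantOrder (MulAction.stabilizer G o)) : PartialOrder G where
  le a b := S.Lt (a • o) (b • o) ∨
    ∃ s : MulAction.stabilizer G o, a * s = b ∧ 1 ≤ s
  le_refl a := Or.inr ⟨1, by simp, le_rfl⟩
  le_trans a b c := by
    rintro (h1 | ⟨s, rfl, hs⟩) (h2 | ⟨t, rfl, ht⟩)
    · exact Or.inl (S.lt_trans h1 h2)
    · refine Or.inl ?_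
      rwa [mul_smul, t.2]
    · refine Or.inl ?_
      rwa [mul_smul, s.2] at h2
    · exact Or.inr ⟨s * t, by simp [mul_assoc], hs.trans (by simpa using hL s 1 t ht)⟩
  le_antisymm a b := by
    rintro (h1 | ⟨s, rfl, hs⟩) (h2 | ⟨t, ht', ht⟩)
    · exact absurd h2.2 (S.not_up_dn h1.1)
    · have ht2 : (t : G) • o = o := t.2
      rw [← ht', mul_smul, ht2] at h1
      exact absurd h1.1 (S.not_mem_up _)
    · have hs2 : (s : G) • o = o := s.2
      rw [mul_smul, hs2] at h2
      exact absurd h2.1 (S.not_mem_up _)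
    · have hst : s * t = 1 := by
        rw [mul_assoc, mul_eq_left] at ht'
        exact Subtype.ext ht'
      have := hL s 1 t ht
      rw [hst, mul_one] at this
      simp [le_antisymm this hs]

end SideSystem

/-! ### The theorem -/

/-- **Left-invariant orders from actions on simply connected 1-manifolds.** -/
theorem theorem5p3 {G T : Type*} [Group G] [Countable G]
    [TopologicalSpace T] [ChartedSpace ℝ T] [IsOrientedOneManifold T] [SimplyConnectedSpace T]
    [MulAction G T] [ContinuousConstSMul G T]
    (horient : ∀ g : G, IsOrientationPreserving (fun x : T => g • x))
    (hmin : IsTreeMinimalAction T G)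
    (hend : ¬ FixesUniqueEnd T G)
    (hstab : ∃ x : T, IsLeftOrderable (MulAction.stabilizer G x)) :
    ∃ _ : PartialOrder G, IsLeftInvariantOrder G ∧ IsSimplyConnectedOrder G ∧
      IsRectifiableOrder G ∧ ¬ IsTrivialOrder G := by
  obtain ⟨o, L, hL⟩ := hstab
  have hinv : (manifoldSides T).IsInvariant G := smul_mem_sides_iff horient
  obtain ⟨hup, hdn, hUD⟩ := hinv.orbit_branching hmin hend o
  let P : PartialOrder G := (manifoldSides T).orbitOrder o hL
  have hfib : (manifoldSides T).IsFiberedOrder (fun g : G => g • o) := by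
    refine ⟨fun a b => Or.inl, fun a b hab => hab.imp id ?_, fun a b hab => ?_, hup, hdn⟩
    · rintro ⟨s, rfl, -⟩
      have hs : (s : G) • o = o := s.2
      simp only [mul_smul, hs]
    -- The fibers of the orbit map are the left cosets of the stabilizer, so two elements of a fiber
    -- are compared by the sign of `a⁻¹ * b`, which left translation does not change.
    · have hs : a⁻¹ * b ∈ MulAction.stabilizer G o := by
        rw [MulAction.mem_stabilizer_iff, mul_smul, ← show a • o = b • o from hab, inv_smul_smul]
      rcases le_total 1 (⟨a⁻¹ * b, hs⟩ : MulAction.stabilizer G o) with h1 | h1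
      · exact Or.inl (Or.inr ⟨_, by simp, h1⟩)
      · refine Or.inr (Or.inr ⟨⟨a⁻¹ * b, hs⟩⁻¹, by simp, ?_⟩)
        simpa using hL (⟨a⁻¹ * b, hs⟩⁻¹) _ _ h1
  refine ⟨P, fun f g k hgk => ?_, hfib.isSimplyConnectedOrder, hfib.isRectifiableOrder,
    hfib.not_isTrivialOrder hUD⟩
  rcases hgk with hgk | ⟨s, rfl, hs⟩
  · refine Or.inl ?_
    rw [mul_smul, mul_smul]
    exact (hinv.smul_lt f).mpr hgk
  · exact Or.inr ⟨s, by simp [mul_assoc], hs⟩
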